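/- **Definitions.** Let $k$ be an algebraically closed field and let $(a_j)_{j\in J}$ be a finite family of $n=|J|$ positive integers. A *diameter four tree of type* $(a_j)$ over $k$ is an isomorphism class of coverings $\mathbf P^1_k\to\mathbf P^1_k$ that are étale above $\mathbf P^1_k\setminus\{0,1,\infty\}$, tamely ramified above $0,1,\infty$, totally ramified above $\infty$, whose fibre above $0$ consists of $n$ points with ramification indices $(a_j)$, and which have a point $x_\beta$ above $1$ (the centre) such that no other point above $1$ is ramified (the ramification index at $x_\beta$ is then $n$; for $n\ge2$ it is the only ramified point above $1$). Placing the point above $\infty$ at $\infty$, such a covering is a polynomial $\beta\in k[X]$, called a *model* of the tree; two models belong to the same tree if and only if they differ by a substitution $X\mapsto uX+v$ with $u\in k^*$, $v\in k$. A model is *standard* if $0$ is a centre, and *normalized* if moreover $\beta(1)=0$. A standard model $\beta=\prod_{j}(1-x_jX)^{a_j}$ is a *Kummer model* if moreover $\sum_j a_jx_j^{\,n}=1$. For a tree $\mathcal T$ over $\overline{\mathbf Q}$, its splitting field $\mathbf Q(\mathcal T)^\bullet$ is the field generated by the zeros of a normalized model. A tree $\mathcal T$ has *good reduction* at a prime $\mathfrak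 P$ of a number field $L\supseteq\mathbf Q(\mathcal T)^\bullet$ if it has a normalized model with coefficients in the local ring $\mathcal O_{\mathfrak P}$ whose reduction, over an algebraic closure of the residue field, is a normalized model of a tree of the same type. For a prime $\mathfrak p$ of a number field $K$ that need not contain $\mathbf Q(\mathcal T)^\bullet$, good reduction at $\mathfrak p$ means good reduction at every prime above $\mathfrak p$ of every number field containing $K$ and $\mathbf Q(\mathcal T)^\bullet$. **Theorem 8.6.** Let $a_1\le\dots\le a_n$ be positive integers, let $1\le i\le n$, and let $p>n$ be an $a_i$-regular prime, i.e. $p\mid a_i$ and $p\nmid\sum_{j\in S}a_j$ for every nonempty $S\subseteq\{1,\dots,n\}\setminus\{i\}$. Let $K\subset\overline{\mathbf Q}$ be a number field that contains the splitting fields of all trees of type $(a_1,\dots,a_n)$ over $\overline{\mathbf Q}$, the coefficients of all Kummer models of type $(a_1,\dots,\widehat{a_i},\dots,a_n)$ over $\overline{\mathbf Q}$, and the splitting field of $X^{n-1}+a_i$. Let $x$ be a root of $X^{n-1}+a_i$ (so $n\ge2$) and let $\mathfrak p$ be a prime of $\mathcal O_K$ above $p$, with local ring $\mathcal O_{\mathfrak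 p}\subset K$ and decomposition group $D_{\mathfrak p}=\{\tau\in\mathrm{Aut}(K/\mathbf Q):\tau(\mathfrak p)=\mathfrak p\}$. Call *canonical models* of type $(a_1,\dots,a_n)$ the normalized models of type $(a_1,\dots,a_n)$ over $\overline{\mathbf Q}$ with coefficients in $\mathcal O_{\mathfrak p}$. Then: 1. There is a bijection $\Phi$ from the set of canonical models of type $(a_1,\dots,a_n)$ to the set of Kummer models of type $(a_1,\dots,\widehat{a_i},\dots,a_n)$ over $\overline{\mathbf Q}$ such that, for every $\tau\in D_{\mathfrak p}$, every extension $\sigma\in\mathrm{Gal}(\overline{\mathbf Q}/\mathbf Q)$ of $\tau$ and every canonical model $\beta$, the polynomial ${}^\sigma\beta$ (with $\sigma$ acting on the coefficients) is again a canonical model and $$\Phi({}^\sigma\beta)={}^{\widehat\sigma}\Phi(\beta).$$ Here $\widehat\sigma(t)=\frac{\sigma(x)}{x}\,\sigma(t)$ for $t\in\overline{\mathbf Q}$, and ${}^{\widehat\sigma}\prod_{j\ne i}(1-y_jX)^{a_j}=\prod_{j\neq i}(1-\widehat\sigma(y_j)X)^{a_j}$. 2. All diameter four trees of type $(a_1,\dots,\widehat{a_i},\dots,a_n)$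 over $\overline{\mathbf Q}$ have good reduction at $\mathfrak p$. -/

import Mathlib

open Polynomial NumberField IsDedekindDomain
open scoped Pointwise

/-- The field of all algebraic numbers. -/
abbrev QBar : Type := AlgebraicClosure ℚ

section Trees

variable {k : Type*} [Field k] {ι : Type} [Fintype ι]

/-- The ramification index at the affine point `y` of the covering of the projective line
given by the polynomial `β`. -/
noncomputable def ramificationIndex (β : k[X]) (y : k) : ℕ :=
  (β - C (β.eval y)).rootMultiplicity y

/-- `e` is a point above `1`, and no other point above `1` is ramified. -/
def IsCentre (β : k[X]) (e : k) : Prop :=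
  β.eval e = 1 ∧ ∀ y, y ≠ e → β.eval y = 1 → ramificationIndex β y = 1

/-- Polynomial models of diameter four trees of type `a` (over an algebraically closed field `k`):
the coverings of the projective line by itself which are totally ramified above infinity, the
point above infinity being placed at infinity, i.e. polynomials, with the prescribed ramification.
By the Riemann-Hurwitz formula the centre has ramification index `n`, the number of points
above `0`; hence if `n ≥ 2` the centre is the unique ramified point above `1`. -/
structure IsModel (a : ι → ℕ) (β : k[X]) : Prop where
  natDegree_pos : 0 < β.natDegree
  /-- `β` is étale above the complement of `{0, 1, ∞}`. -/
  etale : ∀ y, β.eval y ≠ 0 → β.eval y ≠ 1 → ramificationIndex β y = 1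
  /-- `β` is tamely ramified above `0` and `1`. -/
  tame : ∀ y, β.eval y = 0 ∨ β.eval y = 1 → (ramificationIndex β y : k) ≠ 0
  /-- `β` is tamely ramified at infinity, where the ramification index is the degree. -/
  tame_infinity : (β.natDegree : k) ≠ 0
  /-- The points above `0` have the `a j` as ramification indices. -/
  fiber_zero : ∃ r : ι → k, Function.Injective r ∧ {y | β.eval y = 0} = Set.range r ∧
    ∀ j, ramificationIndex β (r j) = a j
  /-- At most one point above `1` is ramified. -/
  fiber_one : ∃ e, IsCentre β e

/-- Standard models: the centre is at `0`. -/
def IsStandardModel (a : ι → ℕ) (β : k[X]) : Prop :=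
  IsModel a β ∧ IsCentre β 0

/-- Normalized models: the centre is at `0`, and `1` lies above `0`. -/
def IsNormalizedModel (a : ι → ℕ) (β : k[X]) : Prop :=
  IsStandardModel a β ∧ β.eval 1 = 0

/-- Kummer models: the standard models `∏ (1 - x_j X) ^ a_j` with `∑ a_j x_j ^ n = 1`,
where `n` is the number of points above `0`. -/
def IsKummerModel (a : ι → ℕ) (β : k[X]) : Prop :=
  IsStandardModel a β ∧ ∃ x : ι → k, β = ∏ j, (1 - C (x j) * X) ^ a j ∧
    ∑ j, (a j : k) * x j ^ Fintype.card ι = 1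

/-- Isomorphism of polynomial coverings. An automorphism of the projective line that carries one
polynomial covering to another fixes infinity, hence is affine. -/
def modelSetoid (k : Type*) [Field k] (a : ι → ℕ) : Setoid {β : k[X] // IsModel a β} where
  r β₁ β₂ := ∃ u v : k, u ≠ 0 ∧ β₂.1 = β₁.1.comp (C u * X + C v)
  iseqv :=
    { refl := fun β => ⟨1, 0, one_ne_zero, by simp⟩
      symm := by
        rintro β₁ β₂ ⟨u, v, hu, h⟩
        refine ⟨u⁻¹, -(u⁻¹ * v), inv_ne_zero hu, ?_⟩
        rw [h, comp_assoc]
        have : (C u * X + C v).comp (C u⁻¹ * X + C (-(u⁻¹ * v))) = (X : k[X]) := by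
          simp only [add_comp, mul_comp, C_comp, X_comp, mul_add, ← mul_assoc, ← C_mul]
          rw [mul_inv_cancel₀ hu, add_assoc, ← C_add, mul_neg, ← mul_assoc, mul_inv_cancel₀ hu]
          simp
        rw [this, comp_X]
      trans := by
        rintro β₁ β₂ β₃ ⟨u, v, hu, h⟩ ⟨u', v', hu', h'⟩
        refine ⟨u * u', u * v' + v, mul_ne_zero hu hu', ?_⟩
        rw [h', h, comp_assoc]
        congr 1
        simp only [add_comp, mul_comp, C_comp, X_comp, mul_add, C_add, C_mul]
        ring }

/-- The valency class of type `a` over `k`: the diameter four trees of type `a`, i.e. the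
isomorphism classes of coverings with the prescribed ramification. -/
def DiameterFourTree (k : Type*) [Field k] (a : ι → ℕ) : Type _ :=
  Quotient (modelSetoid k a)

/-- `β` is a model associated to the tree `T`. -/
def DiameterFourTree.HasModel {a : ι → ℕ} (T : DiameterFourTree k a) (β : k[X]) : Prop :=
  ∃ h : IsModel a β, Quotient.mk (modelSetoid k a) ⟨β, h⟩ = T

/-- The product of the sums of the nonempty subfamilies of `a`. -/
def subsetSumProduct (a : ι → ℕ) : ℕ :=
  ∏ S : Finset ι with S.Nonempty, ∑ j ∈ S, a j

/-- The type obtained from `a` by omitting the entry of index `i`. -/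
def omitEntry (a : ι → ℕ) (i : ι) : {j // j ≠ i} → ℕ :=
  fun j => a j

/-- `p` is `a i`-regular. -/
def IsRegularPrime [DecidableEq ι] (a : ι → ℕ) (i : ι) (p : ℕ) : Prop :=
  p.Prime ∧ p ∣ a i ∧ ¬ p ∣ subsetSumProduct (omitEntry a i)

end Trees

section Fields

variable {ι : Type} [Fintype ι]

/-- The splitting field of a tree: it is generated by the zeros of its normalized models
(any one of them suffices, since all of them generate the same field). -/
noncomputable def DiameterFourTree.splittingField {a : ι → ℕ} (T : DiameterFourTree QBar a) :
    IntermediateField ℚ QBar :=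
  IntermediateField.adjoin ℚ
    {z | ∃ β : QBar[X], T.HasModel β ∧ IsNormalizedModel a β ∧ β.eval z = 0}

/-- The splitting field of a valency class. -/
noncomputable def valencySplittingField (a : ι → ℕ) : IntermediateField ℚ QBar :=
  ⨆ T : DiameterFourTree QBar a, T.splittingField

/-- The field over which the Kummer models of a tree are defined. -/
noncomputable def DiameterFourTree.kummerField {a : ι → ℕ} (T : DiameterFourTree QBar a) :
    IntermediateField ℚ QBar :=
  IntermediateField.adjoin ℚ
    {z | ∃ β : QBar[X], T.HasModel β ∧ IsKummerModel a β ∧ ∃ m, β.coeff m = z}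

/-- The compositum of the fields over which the Kummer models of a valency class are defined. -/
noncomputable def valencyKummerField (a : ι → ℕ) : IntermediateField ℚ QBar :=
  ⨆ T : DiameterFourTree QBar a, T.kummerField

end Fields

section Reduction

variable {ι : Type} [Fintype ι] {F : Type*} [Field F] [NumberField F]

/-- The local ring of the ring of integers of `F` at the prime `𝔭`. -/
noncomputable abbrev localRingAt (𝔭 : HeightOneSpectrum (𝓞 F)) : ValuationSubring F :=
  (𝔭.valuation F).valuationSubring

/-- The residue field at the prime `𝔭`. -/
abbrev residueFieldAt (𝔭 : HeightOneSpectrum (𝓞 F)) : Type _ :=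
  IsLocalRing.ResidueField (localRingAt 𝔭)

/-- A polynomial over the local ring at `𝔭`, seen over the algebraic numbers. -/
noncomputable def toQBar [Algebra F QBar] (𝔭 : HeightOneSpectrum (𝓞 F))
    (β : (localRingAt 𝔭)[X]) : QBar[X] :=
  β.map ((algebraMap F QBar).comp (localRingAt 𝔭).subtype)

/-- The reduction modulo `𝔭` of a polynomial, seen over an algebraic closure of the
residue field. -/
noncomputable def reduceAt (𝔭 : HeightOneSpectrum (𝓞 F)) (β : (localRingAt 𝔭)[X]) :
    (AlgebraicClosure (residueFieldAt 𝔭))[X] :=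
  β.map ((algebraMap (residueFieldAt 𝔭) (AlgebraicClosure (residueFieldAt 𝔭))).comp
    (IsLocalRing.residue (localRingAt 𝔭)))

/-- Some normalized model of `T` is defined over the local ring at `𝔭`, and its reduction
is a normalized model of a tree of the same type. -/
def DiameterFourTree.HasGoodModelAt [Algebra F QBar] {a : ι → ℕ} (T : DiameterFourTree QBar a)
    (𝔭 : HeightOneSpectrum (𝓞 F)) : Prop :=
  ∃ β : (localRingAt 𝔭)[X], T.HasModel (toQBar 𝔭 β) ∧ IsNormalizedModel a (toQBar 𝔭 β) ∧
    IsNormalizedModel a (reduceAt 𝔭 β)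

/-- Good reduction of `T` at a prime `𝔭` of a number field `K`. The normalized models of `T`
need not be defined over `K`, so the condition is imposed at all the primes above `𝔭` of all the
number fields that contain `K` and the splitting field of `T`. -/
def DiameterFourTree.HasGoodReductionAt {a : ι → ℕ} (T : DiameterFourTree QBar a)
    {K : IntermediateField ℚ QBar} [NumberField K] (𝔭 : HeightOneSpectrum (𝓞 K)) : Prop :=
  ∀ (L : IntermediateField ℚ QBar) [NumberField L] (hKL : K ≤ L) (𝔔 : HeightOneSpectrum (𝓞 L)),
    T.splittingField ≤ L →
    𝔔.asIdeal.comap (RingOfIntegers.mapRingHom (IntermediateField.inclusion hKL)) = 𝔭.asIdeal →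
    T.HasGoodModelAt 𝔔

/-- The canonical models of type `a` at `𝔭`: the normalized models defined over the local
ring at `𝔭`. -/
def canonicalModels [Algebra F QBar] (𝔭 : HeightOneSpectrum (𝓞 F)) (a : ι → ℕ) :
    Set QBar[X] :=
  {β | IsNormalizedModel a β ∧ ∃ β₀ : (localRingAt 𝔭)[X], toQBar 𝔭 β₀ = β}

/-- The Kummer models of type `a` over the algebraic numbers. -/
def kummerModels (a : ι → ℕ) : Set QBar[X] :=
  {β | IsKummerModel a β}

/-- The decomposition group of `𝔭`. -/
noncomputable def decompositionGroup (𝔭 : HeightOneSpectrum (𝓞 F)) : Subgroup (F ≃ₐ[ℚ] F) :=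
  MulAction.stabilizer (F ≃ₐ[ℚ] F) 𝔭.asIdeal

end Reduction

section Action

/-- The Galois action on polynomials, through their coefficients. -/
noncomputable def galoisAct (σ : QBar ≃ₐ[ℚ] QBar) (β : QBar[X]) : QBar[X] :=
  β.map (σ : QBar →+* QBar)

/-- The cocycle `σ ↦ σ(x) / x`. -/
noncomputable def kummerCocycle (x : QBar) (σ : QBar ≃ₐ[ℚ] QBar) : QBar :=
  σ x * x⁻¹

/-- The Galois action twisted by the cocycle. -/
noncomputable def twistedAct (x : QBar) (σ : QBar ≃ₐ[ℚ] QBar) (t : QBar) : QBar :=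
  kummerCocycle x σ * σ t

/-- The twisted action on polynomials with constant term `1`, which sends `∏ (1 - y_j X) ^ a_j`
to the polynomial with the twisted conjugates of the `y_j` in place of the `y_j`
(see `twistedGaloisAct_prod`). -/
noncomputable def twistedGaloisAct (x : QBar) (σ : QBar ≃ₐ[ℚ] QBar) (β : QBar[X]) : QBar[X] :=
  (galoisAct σ β).comp (C (kummerCocycle x σ) * X)

theorem twistedGaloisAct_prod {ι : Type} [Fintype ι] (x : QBar) (σ : QBar ≃ₐ[ℚ] QBar)
    (a : ι → ℕ) (y : ι → QBar) :
    twistedGaloisAct x σ (∏ j, (1 - C (y j) * X) ^ a j) =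
      ∏ j, (1 - C (twistedAct x σ (y j)) * X) ^ a j := by
  simp only [twistedGaloisAct, galoisAct, twistedAct, Polynomial.map_prod, Polynomial.map_pow,
    Polynomial.map_sub, Polynomial.map_mul, Polynomial.map_one, map_C, map_X, prod_comp, pow_comp,
    sub_comp, mul_comp, one_comp, C_comp, X_comp]
  refine Finset.prod_congr rfl fun j _ => ?_
  rw [← mul_assoc, ← C_mul, mul_comm (kummerCocycle x σ)]
  rfl

end Action

/-! For `β = ∏ (1 - x_j X) ^ w_j` with `N` zeros, `β'/β` is minus the generating series of the
weighted power sums `p_m = ∑ w_j x_j ^ m`, `m ≥ 1`. Its numerator has degree at most `N - 1`. In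
characteristic zero, with distinct nonzero `x_j`, the point `0` is a centre exactly when this
numerator is a multiple of `X ^ (N - 1)`, that is, when `p_1 = ... = p_{N-1} = 0`. Trees thus become
solutions of power sum equations (`isStandardModel_starPoly`, `IsStandardModel.powerSum_eq_zero`).
Over a field in which no subset sum of `w` vanishes, interpolation (`lt_card_nonzero_values`)
controls these equations. It yields integrality over valuation rings, and good reduction in the
second claim.

For a canonical model of type `(a_1, ..., a_n)`, the inverse zeros are integral and satisfy `p_m =
0` for `1 ≤ m ≤ n - 1`. Modulo `𝔭` the term of `a_i` disappears, so the other `n - 1` inverse zeros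
have `n - 1` vanishing power sums and reduce to `0`; hence `x_i = 1`. Take `ρ ^ (n - 1) = -a_i` and
`x_j = ρ z_j`: the equations become `∑ a_j z_j ^ m = ρ ^ (n - 1 - m)` over `j ≠ i`. Replacing `ρ` by
`0` gives the equations of Kummer models. Both systems have the same reduction, and their Jacobian
is a Vandermonde determinant times units. By Hensel's lemma in a valuation ring of `QBar` above `𝔭`,
solutions of either system correspond to those of the common reduction
(`IsPowerSumSolution.exists_deformation`, `IsPowerSumSolution.starPoly_eq_of_residue_eq`).

The bijection pairs models with the same reduction. It is equivariant because `σ(ρ z_j) = ρ ·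
(σ(ρ)/ρ) σ(z_j)`, so acting on a canonical model twists `z`, and because the decomposition group
respects congruences modulo `𝔭` in `K`. -/

/-! ### Vanishing weighted power sums over a field. -/

section PowerSums

/-- The weighted power sum `∑ w_j x_j ^ m`. -/
def powerSum {ι R : Type*} [Fintype ι] [CommRing R] (w : ι → ℕ) (m : ℕ) (x : ι → R) : R :=
  ∑ j, (w j : R) * x j ^ m

/-- The polynomial `∏ (1 - x_j X) ^ w_j`. -/
noncomputable def starPoly {ι R : Type*} [Fintype ι] [CommRing R] (w : ι → ℕ) (x : ι → R) : R[X] :=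
  ∏ j, (1 - C (x j) * X) ^ w j

/-- All the sums of nonempty subfamilies of `w` are nonzero in `R`. -/
def NonvanishingSubsums {ι : Type*} (R : Type*) [CommRing R] (w : ι → ℕ) : Prop :=
  ∀ S : Finset ι, S.Nonempty → ((∑ j ∈ S, w j : ℕ) : R) ≠ 0

variable {ι R R' k : Type*} [Fintype ι] [CommRing R] [CommRing R'] [Field k] {w : ι → ℕ}

theorem map_powerSum (f : R →+* R') (w : ι → ℕ) (m : ℕ) (x : ι → R) :
    f (powerSum w m x) = powerSum w m (fun j => f (x j)) := by
  simp [powerSum]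

theorem map_starPoly (f : R →+* R') (w : ι → ℕ) (x : ι → R) :
    (starPoly w x).map f = starPoly w (fun j => f (x j)) := by
  simp [starPoly, Polynomial.map_prod]

theorem powerSum_mul (w : ι → ℕ) (m : ℕ) (c : R) (x : ι → R) :
    powerSum w m (fun j => c * x j) = c ^ m * powerSum w m x := by
  simp only [powerSum, Finset.mul_sum]
  exact Finset.sum_congr rfl fun j _ => by ring

theorem starPoly_comp (w : ι → ℕ) (c : R) (x : ι → R) :
    (starPoly w x).comp (C c * X) = starPoly w (fun j => c * x j) := by
  simp only [starPoly, prod_comp, pow_comp, sub_comp, one_comp, mul_comp, C_comp, X_comp]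
  refine Finset.prod_congr rfl fun j _ => ?_
  rw [← mul_assoc, ← C_mul, mul_comm c]

theorem starPoly_eval (w : ι → ℕ) (x : ι → R) (y : R) :
    (starPoly w x).eval y = ∏ j, (1 - x j * y) ^ w j := by
  simp [starPoly, eval_prod]

theorem starPoly_eval_zero (w : ι → ℕ) (x : ι → R) : (starPoly w x).eval 0 = 1 := by
  simp [starPoly_eval]

/-- A weighted sum of the values of a polynomial without constant term is a combination of
power sums. -/
theorem sum_weight_mul_eval_eq_zero {M : ℕ} {x : ι → k}
    (hx : ∀ m, 1 ≤ m → m ≤ M → powerSum w m x = 0) {g : k[X]} (hg : g.coeff 0 = 0)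
    (hdeg : g.natDegree ≤ M) : ∑ j, (w j : k) * g.eval (x j) = 0 := by
  have h (j : ι) : (w j : k) * g.eval (x j) =
      ∑ m ∈ Finset.range (M + 1), g.coeff m * ((w j : k) * x j ^ m) := by
    rw [eval_eq_sum_range' (Nat.lt_succ_of_le hdeg), Finset.mul_sum]
    exact Finset.sum_congr rfl fun m _ => by ring
  simp only [h]
  rw [Finset.sum_comm]
  refine Finset.sum_eq_zero fun m hm => ?_
  rw [← Finset.mul_sum]
  rcases Nat.eq_zero_or_pos m with rfl | hm0
  · rw [hg, zero_mul]
  · have := hx m hm0 (Nat.lt_succ_iff.1 (Finset.mem_range.1 hm))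
    rw [powerSum] at this
    rw [this, mul_zero]

/-- Interpolation: if there were at most `M` nonzero values, a polynomial without constant term, of
degree at most `M`, could vanish at all values but one. Its weighted sum would then be a subset sum
of `w` times a nonzero number, yet it is a combination of vanishing power sums. -/
theorem lt_card_nonzero_values [DecidableEq k] (hw : NonvanishingSubsums k w) {M : ℕ} {x : ι → k}
    (hx : ∀ m, 1 ≤ m → m ≤ M → powerSum w m x = 0) (hne : x ≠ 0) :
    M < ((Finset.univ.image x).erase 0).card := by
  by_contra! hM
  obtain ⟨j₀, hj₀⟩ := Function.ne_iff.1 hne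
  set S := (Finset.univ.image x).erase 0 with hS
  have hmem : x j₀ ∈ S := by simpa [hS] using hj₀
  set g : k[X] := X * ∏ v ∈ S.erase (x j₀), (X - C v) with hg
  have hdeg : g.natDegree ≤ M := by
    refine le_trans ?_ hM
    rw [hg, natDegree_X_mul (Finset.prod_ne_zero_iff.2 fun v _ => X_sub_C_ne_zero v),
      natDegree_prod_of_monic _ _ fun v _ => monic_X_sub_C v]
    simp [Finset.card_erase_add_one hmem]
  have hval (j : ι) (hj : x j ≠ x j₀) : g.eval (x j) = 0 := by
    rw [hg, eval_mul, eval_X, eval_prod]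
    by_cases h0 : x j = 0
    · rw [h0, zero_mul]
    · rw [Finset.prod_eq_zero (i := x j) (by simp [hS, hj, h0]) (by simp), mul_zero]
  have hval₀ : g.eval (x j₀) ≠ 0 := by
    rw [hg, eval_mul, eval_X, eval_prod]
    refine mul_ne_zero hj₀ (Finset.prod_ne_zero_iff.2 fun v hv => ?_)
    rw [eval_sub, eval_X, eval_C, sub_ne_zero]
    exact (Finset.ne_of_mem_erase hv).symm
  have hsum := sum_weight_mul_eval_eq_zero hx (g := g) (by simp [hg]) hdeg
  -- Only the indices sharing the value `x j₀` contribute; their total weight is a nonempty subset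
  -- sum.
  rw [← Finset.sum_filter_add_sum_filter_not _ (fun j => x j = x j₀),
    Finset.sum_eq_zero (s := Finset.univ.filter fun j => ¬ x j = x j₀)
      (fun j hj => by rw [hval j (Finset.mem_filter.1 hj).2, mul_zero]), add_zero,
    Finset.sum_congr rfl (fun j hj => by rw [(Finset.mem_filter.1 hj).2]),
    ← Finset.sum_mul, ← Nat.cast_sum] at hsum
  exact mul_ne_zero (hw _ ⟨j₀, by simp⟩) hval₀ hsum

theorem card_nonzero_values_le [DecidableEq k] (x : ι → k) :
    ((Finset.univ.image x).erase 0).card ≤ Fintype.card ι :=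
  (Finset.card_erase_le).trans Finset.card_image_le

theorem eq_zero_of_powerSum_eq_zero (hw : NonvanishingSubsums k w) {x : ι → k}
    (hx : ∀ m, 1 ≤ m → m ≤ Fintype.card ι → powerSum w m x = 0) : x = 0 := by
  classical
  by_contra hne
  exact absurd (lt_card_nonzero_values hw hx hne) (not_lt.2 (card_nonzero_values_le x))

/-- With `N - 1` vanishing power sums there are at least `N` distinct nonzero values among `N`
entries. -/
theorem injective_of_powerSum_eq_zero (hw : NonvanishingSubsums k w) {x : ι → k}
    (hx : ∀ m, 1 ≤ m → m < Fintype.card ι → powerSum w m x = 0) (hne : x ≠ 0) :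
    Function.Injective x ∧ ∀ j, x j ≠ 0 := by
  classical
  have h := lt_card_nonzero_values hw (M := Fintype.card ι - 1)
    (fun m h1 h2 => hx m h1 (by omega)) hne
  have hle : ((Finset.univ.image x).erase 0).card ≤ (Finset.univ.image x).card :=
    Finset.card_erase_le
  have hle' : (Finset.univ.image x).card ≤ Fintype.card ι := Finset.card_image_le
  refine ⟨?_, fun j hj => ?_⟩
  · rw [← Set.injOn_univ, ← Finset.coe_univ, ← Finset.card_image_iff, Finset.card_univ]
    omega
  · have := Finset.card_erase_lt_of_mem (a := (0 : k)) (s := Finset.univ.image x)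
      (by simpa using ⟨j, hj⟩)
    omega

theorem powerSum_card_ne_zero (hw : NonvanishingSubsums k w) {x : ι → k}
    (hx : ∀ m, 1 ≤ m → m < Fintype.card ι → powerSum w m x = 0) (hne : x ≠ 0) :
    powerSum w (Fintype.card ι) x ≠ 0 := fun h =>
  hne <| eq_zero_of_powerSum_eq_zero hw fun m h1 h2 => h2.lt_or_eq.elim (hx m h1) fun e => e ▸ h

end PowerSums

/-! ### The logarithmic derivative as generating series of power sums. -/

section Derivative

variable {ι k : Type*} [Fintype ι] [Field k] {w : ι → ℕ}

/-- The numerator of the logarithmic derivative of `∏ (1 - x_j X) ^ w_j`. -/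
noncomputable def logDerivNum [DecidableEq ι] (w : ι → ℕ) (x : ι → k) : k[X] :=
  -∑ j, C ((w j : k) * x j) * ∏ l ∈ Finset.univ.erase j, (1 - C (x l) * X)

theorem derivative_starPoly [DecidableEq ι] (hw : ∀ j, 0 < w j) (x : ι → k) :
    derivative (starPoly w x) =
      (∏ j, (1 - C (x j) * X) ^ (w j - 1)) * logDerivNum w x := by
  rw [starPoly, derivative_prod_finset, logDerivNum, mul_neg, Finset.mul_sum,
    ← Finset.sum_neg_distrib]
  refine Finset.sum_congr rfl fun j _ => ?_
  rw [← Finset.mul_prod_erase Finset.univ (fun j => (1 - C (x j) * X) ^ (w j - 1))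
    (Finset.mem_univ j)]
  have h : ∏ l ∈ Finset.univ.erase j, (1 - C (x l) * X) ^ w l =
      (∏ l ∈ Finset.univ.erase j, (1 - C (x l) * X) ^ (w l - 1)) *
        ∏ l ∈ Finset.univ.erase j, (1 - C (x l) * X) := by
    rw [← Finset.prod_mul_distrib]
    exact Finset.prod_congr rfl fun l _ => by rw [← pow_succ, Nat.sub_add_cancel (hw l)]
  rw [h, derivative_pow]
  simp only [derivative_sub, derivative_one, derivative_mul, derivative_C, derivative_X, C_mul,
    map_natCast]
  ring

theorem natDegree_logDerivNum_le [DecidableEq ι] (w : ι → ℕ) (x : ι → k) :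
    (logDerivNum w x).natDegree ≤ Fintype.card ι - 1 := by
  rw [logDerivNum, natDegree_neg]
  refine natDegree_sum_le_of_forall_le _ _ fun j _ => ?_
  refine (natDegree_C_mul_le _ _).trans ((natDegree_prod_le _ _).trans ?_)
  refine (Finset.sum_le_card_nsmul _ _ 1 fun l _ => ?_).trans ?_
  · exact (natDegree_sub_le _ _).trans
      (max_le (by simp) ((natDegree_C_mul_le _ _).trans natDegree_X_le))
  · rw [Finset.card_erase_of_mem (Finset.mem_univ j), Finset.card_univ, smul_eq_mul, mul_one]

theorem mk_pow_mul_one_sub (x : k) :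
    PowerSeries.mk (fun m => x ^ m) * (1 - PowerSeries.C x * PowerSeries.X) = 1 := by
  rw [mul_sub, mul_one, mul_comm (PowerSeries.C x), ← mul_assoc]
  ext m
  rcases m with _ | m
  · simp
  · rw [map_sub, PowerSeries.coeff_mul_C, PowerSeries.coeff_succ_mul_X]
    simp [PowerSeries.coeff_one, pow_succ]

/-- The logarithmic derivative of `∏ (1 - x_j X) ^ w_j` is the generating series of the
power sums. -/
theorem logDerivNum_eq_powerSeries [DecidableEq ι] (w : ι → ℕ) (x : ι → k) :
    (logDerivNum w x : PowerSeries k) =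
      -(((∏ l, (1 - C (x l) * X) : k[X]) : PowerSeries k) *
        PowerSeries.mk fun m => powerSum w (m + 1) x) := by
  have hG : PowerSeries.mk (fun m => powerSum w (m + 1) x) =
      ∑ j, PowerSeries.C ((w j : k) * x j) * PowerSeries.mk (fun m => x j ^ m) := by
    ext m
    simp only [PowerSeries.coeff_mk, map_sum, PowerSeries.coeff_C_mul, powerSum]
    exact Finset.sum_congr rfl fun j _ => by ring
  rw [hG, logDerivNum, Polynomial.coe_neg, neg_inj, ← Polynomial.coeToPowerSeries.ringHom_apply,
    map_sum, Finset.mul_sum]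
  refine Finset.sum_congr rfl fun j _ => ?_
  rw [← Finset.mul_prod_erase Finset.univ (fun l => (1 - C (x l) * X : k[X])) (Finset.mem_univ j),
    map_mul, Polynomial.coeToPowerSeries.ringHom_apply, Polynomial.coeToPowerSeries.ringHom_apply,
    Polynomial.coe_mul, Polynomial.coe_C]
  have h1 : ((1 - C (x j) * X : k[X]) : PowerSeries k) = 1 - PowerSeries.C (x j) * PowerSeries.X := by
    simp
  rw [h1]
  linear_combination (-(PowerSeries.C ((w j : k) * x j) *
    ((∏ l ∈ Finset.univ.erase j, (1 - C (x l) * X) : k[X]) : PowerSeries k))) *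
      mk_pow_mul_one_sub (x j)

theorem constantCoeff_prod_one_sub (x : ι → k) :
    PowerSeries.constantCoeff ((∏ l, (1 - C (x l) * X) : k[X]) : PowerSeries k) = 1 := by
  rw [← PowerSeries.coeff_zero_eq_constantCoeff_apply, Polynomial.coeff_coe,
    Polynomial.coeff_zero_eq_eval_zero, eval_prod]
  simp

/-- The series identity kills the coefficients below `N - 1` and identifies the one at `N - 1`,
where `N` is the number of indices; the degree bound kills those above. -/
theorem logDerivNum_eq [DecidableEq ι] [Nonempty ι] {x : ι → k}
    (hx : ∀ m, 1 ≤ m → m < Fintype.card ι → powerSum w m x = 0) :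
    logDerivNum w x = C (-powerSum w (Fintype.card ι) x) * X ^ (Fintype.card ι - 1) := by
  have hN : 1 ≤ Fintype.card ι := Fintype.card_pos
  obtain ⟨g, hg⟩ : PowerSeries.X ^ (Fintype.card ι - 1) ∣
      PowerSeries.mk (fun m => powerSum w (m + 1) x) :=
    PowerSeries.X_pow_dvd_iff.2 fun m hm => by
      rw [PowerSeries.coeff_mk, hx _ (by omega) (by omega)]
  have hg0 : PowerSeries.constantCoeff g = powerSum w (Fintype.card ι) x := by
    have := congrArg (PowerSeries.coeff (Fintype.card ι - 1)) hg
    rw [PowerSeries.coeff_mk, Nat.sub_add_cancel hN, PowerSeries.coeff_X_pow_mul'] at this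
    simpa using this.symm
  have key := logDerivNum_eq_powerSeries w x
  rw [hg] at key
  ext m
  rw [coeff_C_mul, coeff_X_pow]
  rcases lt_trichotomy m (Fintype.card ι - 1) with h | h | h
  · rw [if_neg h.ne, mul_zero, ← Polynomial.coeff_coe, key, mul_left_comm, ← mul_neg,
      PowerSeries.coeff_X_pow_mul', if_neg (by omega)]
  · rw [if_pos h, mul_one, ← Polynomial.coeff_coe, key, mul_left_comm, ← mul_neg,
      PowerSeries.coeff_X_pow_mul', if_pos h.ge, h, Nat.sub_self,
      PowerSeries.coeff_zero_eq_constantCoeff_apply, map_neg, map_mul,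
      constantCoeff_prod_one_sub, one_mul, hg0]
  · rw [if_neg h.ne', mul_zero]
    exact coeff_eq_zero_of_natDegree_lt ((natDegree_logDerivNum_le w x).trans_lt h)

/-- The product relating the numerator to the generating series has constant term `1`, hence is a
unit among power series, so divisibility by powers of `X` passes to the series. -/
theorem powerSum_eq_zero_of_logDerivNum [DecidableEq ι] {x : ι → k} {N : ℕ}
    (h : X ^ (N - 1) ∣ logDerivNum w x) {m : ℕ} (h1 : 1 ≤ m) (hm : m < N) :
    powerSum w m x = 0 := by
  have h' : (PowerSeries.X : PowerSeries k) ^ (N - 1) ∣ (logDerivNum w x : PowerSeries k) := by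
    obtain ⟨q, hq⟩ := h
    exact ⟨q, by rw [hq]; simp⟩
  rw [logDerivNum_eq_powerSeries, dvd_neg] at h'
  have hu : IsUnit ((∏ l, (1 - C (x l) * X) : k[X]) : PowerSeries k) := by
    rw [PowerSeries.isUnit_iff_constantCoeff, constantCoeff_prod_one_sub]
    exact isUnit_one
  have := PowerSeries.X_pow_dvd_iff.1 (hu.dvd_mul_left.1 h') (m - 1) (by omega)
  rwa [PowerSeries.coeff_mk, Nat.sub_add_cancel h1] at this

end Derivative

/-! ### Standard models as families with vanishing power sums. -/

section Models

theorem nonvanishingSubsums_of_pos {ι R : Type*} [CommRing R] [CharZero R] {w : ι → ℕ}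
    (hw : ∀ j, 0 < w j) : NonvanishingSubsums R w := fun S ⟨j, hj⟩ => by
  rw [Nat.cast_ne_zero]
  exact (Finset.sum_pos (fun l _ => hw l) ⟨j, hj⟩).ne'

theorem NonvanishingSubsums.pos {ι R : Type*} [CommRing R] {w : ι → ℕ}
    (hw : NonvanishingSubsums R w) (j : ι) : 0 < w j :=
  Nat.pos_of_ne_zero fun h => hw {j} (Finset.singleton_nonempty j) (by simp [h])

variable {ι : Type} {k : Type*} [Fintype ι] [Field k] {w : ι → ℕ}

theorem one_sub_C_mul_X_eq {x : k} (hx : x ≠ 0) :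
    (1 - C x * X : k[X]) = C (-x) * (X - C x⁻¹) := by
  rw [mul_sub, ← C_mul, neg_mul, mul_inv_cancel₀ hx, C_neg, C_neg, C_1]
  ring

theorem starPoly_eval_eq_zero_iff (hw : ∀ j, 0 < w j) (x : ι → k) (y : k) :
    (starPoly w x).eval y = 0 ↔ ∃ j, x j * y = 1 := by
  rw [starPoly_eval, Finset.prod_eq_zero_iff]
  simp only [Finset.mem_univ, true_and]
  refine exists_congr fun j => ?_
  rw [pow_eq_zero_iff (hw j).ne', sub_eq_zero, eq_comm]

theorem rootMultiplicity_starPoly {x : ι → k} (hinj : Function.Injective x) (hx : ∀ j, x j ≠ 0)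
    (j : ι) : (starPoly w x).rootMultiplicity (x j)⁻¹ = w j := by
  classical
  set g : k[X] := ∏ l ∈ Finset.univ.erase j, (1 - C (x l) * X) ^ w l with hg
  have hgj : g.eval (x j)⁻¹ ≠ 0 := by
    rw [hg, eval_prod, Finset.prod_ne_zero_iff]
    intro l hl
    simp only [eval_pow, eval_sub, eval_one, eval_mul, eval_C, eval_X]
    refine pow_ne_zero _ (sub_ne_zero.2 fun h => Finset.ne_of_mem_erase hl (hinj ?_))
    exact ((mul_inv_eq_one₀ (hx j)).1 h.symm)
  have hg0 : g ≠ 0 := fun h => hgj (by rw [h, eval_zero])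
  have hc : C ((-x j) ^ w j) * g ≠ 0 :=
    mul_ne_zero (C_ne_zero.2 (pow_ne_zero _ (neg_ne_zero.2 (hx j)))) hg0
  have h : starPoly w x = C ((-x j) ^ w j) * g * (X - C (x j)⁻¹) ^ w j := by
    rw [starPoly, ← Finset.mul_prod_erase _ _ (Finset.mem_univ j), one_sub_C_mul_X_eq (hx j),
      mul_pow, C_pow]
    ring
  rw [h, rootMultiplicity_mul_X_sub_C_pow hc, rootMultiplicity_eq_zero, zero_add]
  rw [IsRoot, eval_mul, eval_C]
  exact mul_ne_zero (pow_ne_zero _ (neg_ne_zero.2 (hx j))) hgj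

theorem natDegree_starPoly {x : ι → k} (hx : ∀ j, x j ≠ 0) :
    (starPoly w x).natDegree = ∑ j, w j := by
  rw [starPoly, natDegree_prod]
  · refine Finset.sum_congr rfl fun j _ => ?_
    rw [natDegree_pow, one_sub_C_mul_X_eq (hx j), natDegree_C_mul (neg_ne_zero.2 (hx j)),
      natDegree_X_sub_C, mul_one]
  · intro j _ h
    have := congrArg (eval 0) h
    simp at this

theorem ramificationIndex_eq_one {β : k[X]} {y : k} (h : (derivative β).eval y ≠ 0) :
    ramificationIndex β y = 1 := by
  have hd : derivative (β - C (β.eval y)) = derivative β := by simp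
  have h0 : β - C (β.eval y) ≠ 0 := fun e => h (by rw [← hd, e]; simp)
  have hroot : (β - C (β.eval y)).IsRoot y := by simp
  refine le_antisymm (not_lt.1 fun hlt => h ?_) ((rootMultiplicity_pos h0).2 hroot)
  rw [← hd]
  exact ((one_lt_rootMultiplicity_iff_isRoot h0).1 hlt).2

theorem derivative_eval_ne_zero {β : k[X]} (hβ : 0 < β.natDegree) {y : k}
    (h : ramificationIndex β y = 1) : (derivative β).eval y ≠ 0 := fun hd => by
  have h0 : β - C (β.eval y) ≠ 0 := fun e => by
    rw [sub_eq_zero.1 e, natDegree_C] at hβ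
    exact hβ.false
  have := (one_lt_rootMultiplicity_iff_isRoot (t := y) h0).2 ⟨by simp, by simpa using hd⟩
  rw [ramificationIndex] at h
  omega

/-- Distinct nonzero inverse zeros whose power sums vanish up to order `n - 1` give a standard
model, as long as the ramification stays tame. -/
theorem isStandardModel_starPoly [Nonempty ι] (hw : NonvanishingSubsums k w)
    (htame : ∀ e, 1 ≤ e → e ≤ Fintype.card ι → (e : k) ≠ 0) {x : ι → k}
    (hx : ∀ m, 1 ≤ m → m < Fintype.card ι → powerSum w m x = 0) (hne : x ≠ 0) :
    IsStandardModel w (starPoly w x) := by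
  classical
  obtain ⟨hinj, hx0⟩ := injective_of_powerSum_eq_zero hw hx hne
  have hpos := hw.pos
  have hD := derivative_starPoly hpos x
  rw [logDerivNum_eq hx] at hD
  set c := -powerSum w (Fintype.card ι) x
  set D : k[X] := ∏ j, (1 - C (x j) * X) ^ (w j - 1) with hDdef
  have hc : c ≠ 0 := neg_ne_zero.2 (powerSum_card_ne_zero hw hx hne)
  have hzero (y : k) : (starPoly w x).eval y = 0 ↔ ∃ j, (x j)⁻¹ = y := by
    rw [starPoly_eval_eq_zero_iff hpos]
    exact exists_congr fun j => by
      rw [mul_comm, mul_eq_one_iff_eq_inv₀ (hx0 j), eq_comm]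
  have hunr (y : k) (hy : y ≠ 0) (hy' : (starPoly w x).eval y ≠ 0) :
      ramificationIndex (starPoly w x) y = 1 := by
    refine ramificationIndex_eq_one ?_
    rw [hD, eval_mul, eval_mul, eval_C, eval_pow, eval_X]
    refine mul_ne_zero ?_ (mul_ne_zero hc (pow_ne_zero _ hy))
    rw [starPoly_eval, Finset.prod_ne_zero_iff] at hy'
    rw [hDdef, eval_prod, Finset.prod_ne_zero_iff]
    intro j hj
    have := (pow_ne_zero_iff (hpos j).ne').1 (hy' j hj)
    simpa using pow_ne_zero _ this
  have hdeg : (starPoly w x).natDegree = ∑ j, w j := natDegree_starPoly hx0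
  have hne0 : starPoly w x - C 1 ≠ 0 := fun e => by
    have : (starPoly w x).natDegree = 0 := by rw [sub_eq_zero.1 e, natDegree_C]
    exact hw Finset.univ Finset.univ_nonempty (by rw [← hdeg, this, Nat.cast_zero])
  -- Tameness at the centre: its index is at most the number `N` of points above `0`. A larger index
  -- would make `X ^ N` divide the derivative `D · c X ^ (N - 1)`, whereas `D(0) = 1` and `c ≠ 0`.
  have h0 : (ramificationIndex (starPoly w x) 0 : k) ≠ 0 := by
    rw [ramificationIndex, starPoly_eval_zero]
    refine htame _ ((rootMultiplicity_pos hne0).2 (by simp [starPoly_eval_zero])) ?_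
    obtain ⟨q, hq⟩ := pow_rootMultiplicity_dvd (starPoly w x - C 1) 0
    set e := (starPoly w x - C 1).rootMultiplicity 0
    by_contra! he
    have hdvd : X ^ (e - 1) ∣ derivative (starPoly w x) := by
      have : derivative (starPoly w x) = derivative (starPoly w x - C 1) := by simp
      rw [this, hq, C_0, sub_zero, derivative_mul, derivative_X_pow]
      exact dvd_add (Dvd.dvd.mul_right (Dvd.intro_left _ rfl) _)
        (Dvd.dvd.mul_right (pow_dvd_pow _ (Nat.sub_le _ _)) _)
    rw [hD, X_pow_dvd_iff] at hdvd
    have hcard : 0 < Fintype.card ι := Fintype.card_pos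
    have := hdvd (Fintype.card ι - 1) (by omega)
    rw [← mul_assoc, coeff_mul_X_pow', if_pos le_rfl, Nat.sub_self, coeff_mul_C,
      coeff_zero_eq_eval_zero, hDdef, eval_prod] at this
    simp [hc] at this
  have hcentre : IsCentre (starPoly w x) 0 :=
    ⟨starPoly_eval_zero w x, fun y hy h1 => hunr y hy (by rw [h1]; exact one_ne_zero)⟩
  refine ⟨⟨?_, ?_, ?_, ?_, ⟨fun j => (x j)⁻¹, fun j l h => hinj (inv_injective h), ?_, ?_⟩,
    ⟨0, hcentre⟩⟩, hcentre⟩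
  · rw [hdeg]
    exact Finset.sum_pos (fun j _ => hpos j) Finset.univ_nonempty
  · exact fun y hy hy1 => hunr y (fun h => hy1 (by rw [h, starPoly_eval_zero])) hy
  · rintro y (hy | hy)
    · obtain ⟨j, rfl⟩ := (hzero y).1 hy
      rw [ramificationIndex, hy, C_0, sub_zero, rootMultiplicity_starPoly hinj hx0]
      simpa using hw {j} (Finset.singleton_nonempty j)
    · by_cases h : y = 0
      · rwa [h]
      · rw [hunr y h (by rw [hy]; exact one_ne_zero), Nat.cast_one]
        exact one_ne_zero
  · rw [hdeg]
    exact hw _ Finset.univ_nonempty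
  · ext y
    exact hzero y
  · intro j
    rw [ramificationIndex, (hzero _).2 ⟨j, rfl⟩, C_0, sub_zero, rootMultiplicity_starPoly hinj hx0]

theorem IsModel.pos {ι : Type} {w : ι → ℕ} {β : k[X]} (h : IsModel w β) (j : ι) : 0 < w j := by
  obtain ⟨r, -, hr, hw⟩ := h.fiber_zero
  have h1 : β.eval (r j) = 0 := hr.ge ⟨j, rfl⟩
  have := h.tame (r j) (Or.inl h1)
  rw [hw] at this
  exact Nat.pos_of_ne_zero fun e => this (by simp [e])

/-- The model has as many distinct zeros as indices, and each is the inverse of a nonzero `x j`;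
counting leaves no room for a repetition or a zero. -/
theorem IsModel.injective_of_eq_starPoly [CharZero k] {x : ι → k}
    (h : IsModel w (starPoly w x)) : Function.Injective x ∧ ∀ j, x j ≠ 0 := by
  classical
  have hpos := h.pos
  obtain ⟨r, hinj, hr, -⟩ := h.fiber_zero
  have hsub : Finset.univ.image r ⊆ ((Finset.univ.image x).erase 0).image (·⁻¹) := fun y hy => by
    have hy' : (starPoly w x).eval y = 0 := hr.ge (by simpa using hy)
    obtain ⟨j, hj⟩ := (starPoly_eval_eq_zero_iff hpos x y).1 hy'
    rw [Finset.mem_image]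
    refine ⟨x j, Finset.mem_erase.2 ⟨left_ne_zero_of_mul_eq_one hj, by simp⟩, ?_⟩
    exact inv_eq_of_mul_eq_one_right hj
  have h1 : Fintype.card ι ≤ ((Finset.univ.image x).erase 0).card := by
    rw [← Finset.card_univ, ← Finset.card_image_of_injective _ hinj]
    exact (Finset.card_le_card hsub).trans Finset.card_image_le
  have hle : ((Finset.univ.image x).erase 0).card ≤ (Finset.univ.image x).card :=
    Finset.card_erase_le
  have hle' : (Finset.univ.image x).card ≤ Fintype.card ι := Finset.card_image_le
  refine ⟨?_, fun j hj => ?_⟩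
  · rw [← Set.injOn_univ, ← Finset.coe_univ, ← Finset.card_image_iff, Finset.card_univ]
    omega
  · have := Finset.card_erase_lt_of_mem (a := (0 : k)) (s := Finset.univ.image x)
      (by simpa using ⟨j, hj⟩)
    omega

theorem IsModel.exists_eq_starPoly [IsAlgClosed k] {β : k[X]} (h : IsModel w β)
    (h0 : β.eval 0 = 1) : ∃ x, β = starPoly w x := by
  classical
  obtain ⟨r, hinj, hr, hw⟩ := h.fiber_zero
  have hroot (j : ι) : β.eval (r j) = 0 := hr.ge ⟨j, rfl⟩
  have hr0 (j : ι) : r j ≠ 0 := fun e => by simpa [e, h0] using hroot j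
  have hβ : β ≠ 0 := fun e => by simp [e] at h0
  have hfin : β.roots.toFinset = Finset.univ.image r := by
    ext y
    rw [Multiset.mem_toFinset, mem_roots hβ]
    have : β.IsRoot y ↔ y ∈ Set.range r := by rw [← hr]; rfl
    simpa using this
  have hprod := (IsAlgClosed.splits β).eq_prod_roots
  rw [prod_multiset_root_eq_finset_root, hfin, Finset.prod_image fun _ _ _ _ e => hinj e] at hprod
  have hm (j : ι) : β.rootMultiplicity (r j) = w j := by
    have := hw j
    rwa [ramificationIndex, hroot, C_0, sub_zero] at this
  simp only [hm] at hprod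
  have hstar : β = C (β.leadingCoeff * ∏ j, (-r j) ^ w j) * starPoly w fun j => (r j)⁻¹ := by
    rw [C_mul, map_prod, mul_assoc, starPoly, ← Finset.prod_mul_distrib]
    refine hprod.trans ?_
    congr 1
    refine Finset.prod_congr rfl fun j _ => ?_
    rw [one_sub_C_mul_X_eq (inv_ne_zero (hr0 j)), inv_inv, C_pow, ← mul_pow, ← mul_assoc, ← C_mul,
      neg_mul_neg, mul_inv_cancel₀ (hr0 j), C_1, one_mul]
  have hc := congrArg (eval 0) hstar
  rw [eval_mul, eval_C, starPoly_eval_zero, mul_one, h0] at hc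
  rw [← hc, C_1, one_mul] at hstar
  exact ⟨_, hstar⟩

/-- The power sums of the inverse zeros of a standard model vanish up to order `n - 1`. -/
theorem IsStandardModel.powerSum_eq_zero [IsAlgClosed k] [CharZero k] {x : ι → k}
    (h : IsStandardModel w (starPoly w x)) {m : ℕ} (h1 : 1 ≤ m) (hm : m < Fintype.card ι) :
    powerSum w m x = 0 := by
  classical
  obtain ⟨h, hc⟩ := h
  obtain ⟨hinj, hx0⟩ := h.injective_of_eq_starPoly
  have hpos := h.pos
  have hD := derivative_starPoly hpos x
  set D : k[X] := ∏ j, (1 - C (x j) * X) ^ (w j - 1) with hDdef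
  have hD0 : derivative (starPoly w x) ≠ 0 := fun e => by
    have := derivative_eq_zero.1 e
    have := h.natDegree_pos
    omega
  have hL0 : logDerivNum w x ≠ 0 := fun e => hD0 (by rw [hD, e, mul_zero])
  have hDne : D ≠ 0 := fun e => hD0 (by rw [hD, e, zero_mul])
  -- Away from `0`, a zero of the numerator is impossible: at a zero of the model exactly one
  -- summand survives, and it is nonzero; elsewhere the model is unramified, so its derivative does
  -- not vanish.
  have hzero (y : k) (hy : (logDerivNum w x).eval y = 0) : y = 0 := by
    by_contra hy0
    by_cases hβ : (starPoly w x).eval y = 0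
    · obtain ⟨j, hj⟩ := (starPoly_eval_eq_zero_iff hpos x y).1 hβ
      rw [logDerivNum, eval_neg, neg_eq_zero, eval_finsetSum, Finset.sum_eq_single j] at hy
      · rw [eval_mul, eval_C, mul_eq_zero, eval_prod, Finset.prod_eq_zero_iff] at hy
        rcases hy with hy | ⟨l, hl, hy⟩
        · exact mul_ne_zero (Nat.cast_ne_zero.2 (hpos j).ne') (hx0 j) hy
        · simp only [eval_sub, eval_one, eval_mul, eval_C, eval_X, sub_eq_zero] at hy
          refine Finset.ne_of_mem_erase hl (hinj (mul_right_cancel₀ hy0 ?_))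
          rw [← hy, hj]
      · intro l _ hl
        rw [eval_mul, eval_prod, Finset.prod_eq_zero (i := j)
          (Finset.mem_erase.2 ⟨hl.symm, Finset.mem_univ j⟩) (by simp [hj]), mul_zero]
      · simp
    · refine derivative_eval_ne_zero h.natDegree_pos (y := y) ?_ (by rw [hD, eval_mul, hy, mul_zero])
      by_cases hβ1 : (starPoly w x).eval y = 1
      · exact hc.2 y hy0 hβ1
      · exact h.etale y hβ hβ1
  -- In characteristic zero the derivative has degree `∑ w_j - 1`, of which `D` accounts for `∑ (w_j
  -- - 1)`. All `N - 1` roots of the numerator are therefore at `0`.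
  have hdeg : (logDerivNum w x).natDegree = Fintype.card ι - 1 := by
    have hdD : D.natDegree = ∑ j, (w j - 1) := natDegree_starPoly (w := fun j => w j - 1) hx0
    have hd := natDegree_mul hDne hL0
    rw [← hD, natDegree_derivative, natDegree_starPoly hx0, hdD] at hd
    have hsum : ∑ j, w j = ∑ j, (w j - 1) + Fintype.card ι := by
      rw [← Finset.card_univ, Finset.card_eq_sum_ones, ← Finset.sum_add_distrib]
      exact Finset.sum_congr rfl fun j _ => (Nat.sub_add_cancel (hpos j)).symm
    omega
  refine powerSum_eq_zero_of_logDerivNum (N := Fintype.card ι) ?_ h1 hm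
  have hsp := IsAlgClosed.splits (logDerivNum w x)
  have hroots : (logDerivNum w x).roots = Multiset.replicate (Fintype.card ι - 1) 0 := by
    rw [Multiset.eq_replicate]
    exact ⟨by rw [← hsp.natDegree_eq_card_roots, hdeg], fun y hy => hzero y (isRoot_of_mem_roots hy)⟩
  rw [hsp.eq_prod_roots, hroots, Multiset.map_replicate, Multiset.prod_replicate, C_0, sub_zero]
  exact Dvd.intro_left _ rfl

theorem ramificationIndex_comp (β : k[X]) {u : k} (hu : u ≠ 0) (v y : k) :
    ramificationIndex (β.comp (C u * X + C v)) y = ramificationIndex β (u * y + v) := by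
  have h := rootMultiplicity_comp_C_mul_X_add_C (β - C (β.eval (u * y + v))) u v y hu.isUnit
  rw [sub_comp, C_comp] at h
  rw [ramificationIndex, ramificationIndex, ← h]
  simp [eval_comp]

theorem IsCentre.comp {β : k[X]} {u v e : k} (hu : u ≠ 0) (h : IsCentre β (u * e + v)) :
    IsCentre (β.comp (C u * X + C v)) e := by
  refine ⟨by simpa [eval_comp] using h.1, fun y hy h1 => ?_⟩
  rw [ramificationIndex_comp β hu]
  refine h.2 _ (fun he => hy (mul_left_cancel₀ hu (add_right_cancel he))) ?_
  simpa [eval_comp] using h1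

theorem IsModel.comp {ι : Type} {w : ι → ℕ} {β : k[X]} (h : IsModel w β) {u : k} (hu : u ≠ 0) (v : k) :
    IsModel w (β.comp (C u * X + C v)) := by
  have heval (y : k) : (β.comp (C u * X + C v)).eval y = β.eval (u * y + v) := by
    simp [eval_comp]
  have hdeg : (β.comp (C u * X + C v)).natDegree = β.natDegree := by
    rw [natDegree_comp, natDegree_linear hu, mul_one]
  have hinv (z : k) : u * (u⁻¹ * (z - v)) + v = z := by
    rw [mul_inv_cancel_left₀ hu, sub_add_cancel]
  refine ⟨by rw [hdeg]; exact h.natDegree_pos, ?_, ?_, by rw [hdeg]; exact h.tame_infinity, ?_, ?_⟩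
  · intro y
    rw [heval, ramificationIndex_comp β hu]
    exact h.etale _
  · intro y
    rw [heval, ramificationIndex_comp β hu]
    exact h.tame _
  · obtain ⟨r, hinj, hr, hw⟩ := h.fiber_zero
    refine ⟨fun j => u⁻¹ * (r j - v), fun j l e => hinj ?_, ?_, fun j => ?_⟩
    · exact sub_left_injective (mul_left_cancel₀ (inv_ne_zero hu) e)
    · ext y
      have : β.eval (u * y + v) = 0 ↔ u * y + v ∈ Set.range r := by rw [← hr]; rfl
      rw [Set.mem_ofPred_eq, heval, this]
      refine exists_congr fun j => ⟨fun e => ?_, fun e => ?_⟩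
      · dsimp only
        rw [e, add_sub_cancel_right, inv_mul_cancel_left₀ hu]
      · rw [← e, hinv]
    · rw [ramificationIndex_comp β hu, hinv, hw]
  · obtain ⟨e, he⟩ := h.fiber_one
    refine ⟨u⁻¹ * (e - v), IsCentre.comp hu ?_⟩
    rwa [hinv]

end Models

/-! ### Multivariate Hensel's lemma and Henselian valuation rings. -/

section Hensel

/-- Multivariate Hensel's lemma: a zero modulo the maximal ideal of a square system of polynomials
with invertible Jacobian lifts to a zero. -/
theorem HenselianLocalRing.exists_lift_of_isUnit_jacobian {R : Type*} [CommRing R]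
    [HenselianLocalRing R] {σ : Type} [Fintype σ] [DecidableEq σ] (F : σ → MvPolynomial σ R)
    (y₀ : σ → R) (h₀ : ∀ i, MvPolynomial.eval y₀ (F i) ∈ IsLocalRing.maximalIdeal R)
    (hJ : IsUnit (Matrix.of fun i j => MvPolynomial.eval y₀ (MvPolynomial.pderiv j (F i))).det) :
    ∃ y : σ → R, (∀ i, MvPolynomial.eval y (F i) = 0) ∧
      ∀ j, y j - y₀ j ∈ IsLocalRing.maximalIdeal R := by
  -- Inverting the Jacobian in the algebra of the system makes it étale; `y₀` gives a point of it
  -- over the residue field, to be lifted to `R`.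
  let A₀ := MvPolynomial σ R ⧸ Ideal.span (Set.range F)
  let P : Algebra.PreSubmersivePresentation R A₀ σ σ :=
    Algebra.PreSubmersivePresentation.naive (v := F) id Function.injective_id
  let δ : A₀ := P.jacobian
  let A := Localization.Away δ
  let Q : Algebra.PreSubmersivePresentation A₀ A Unit Unit :=
    Algebra.PreSubmersivePresentation.localizationAway A δ
  let S : Algebra.SubmersivePresentation R A (Unit ⊕ σ) (Unit ⊕ σ) :=
    { toPreSubmersivePresentation := Q.comp P
      jacobian_isUnit := by
        rw [Algebra.PreSubmersivePresentation.comp_jacobian_eq_jacobian_smul_jacobian,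
          Algebra.smul_def, IsUnit.mul_iff]
        refine ⟨IsLocalization.Away.algebraMap_isUnit δ, ?_⟩
        rw [Algebra.PreSubmersivePresentation.localizationAway_jacobian]
        exact IsLocalization.Away.algebraMap_isUnit δ }
  have hS : Algebra.IsStandardSmoothOfRelativeDimension 0 R A :=
    S.isStandardSmoothOfRelativeDimension (by simp [Algebra.Presentation.dimension])
  have hA : Algebra.Etale R A := inferInstance
  let κ := IsLocalRing.ResidueField R
  have hres (g : MvPolynomial σ R) :
      MvPolynomial.aeval (fun j => IsLocalRing.residue R (y₀ j)) g =
        IsLocalRing.residue R (MvPolynomial.eval y₀ g) := by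
    rw [MvPolynomial.aeval_def, MvPolynomial.eval₂_eq_eval_map, MvPolynomial.map_eval]
    rfl
  let φ₀ : A₀ →ₐ[R] κ := Ideal.Quotient.liftₐ (Ideal.span (Set.range F))
    (MvPolynomial.aeval fun j => IsLocalRing.residue R (y₀ j)) (by
      intro g hg
      have : Ideal.span (Set.range F) ≤ RingHom.ker
          (MvPolynomial.aeval (R := R) fun j => IsLocalRing.residue R (y₀ j)) := by
        rw [Ideal.span_le]
        rintro _ ⟨i, rfl⟩
        rw [SetLike.mem_coe, RingHom.mem_ker, hres, IsLocalRing.residue_eq_zero_iff]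
        exact h₀ i
      exact this hg)
  have hφ₀ (g : MvPolynomial σ R) : φ₀ (Ideal.Quotient.mk _ g) =
      IsLocalRing.residue R (MvPolynomial.eval y₀ g) := hres g
  have hδ : IsUnit (φ₀ δ) := by
    have h1 : δ = Ideal.Quotient.mk _ P.jacobiMatrix.det := by
      refine P.jacobian_eq_jacobiMatrix_det.trans ((P.algebraMap_apply _).trans ?_)
      have : MvPolynomial.aeval P.val = Ideal.Quotient.mkₐ R (Ideal.span (Set.range F)) := by
        ext j
        simp only [MvPolynomial.aeval_X, P]
        rfl
      exact DFunLike.congr_fun this _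
    have h2 : MvPolynomial.eval y₀ P.jacobiMatrix.det =
        (Matrix.of fun i j => MvPolynomial.eval y₀ (MvPolynomial.pderiv j (F i))).det := by
      rw [RingHom.map_det, ← Matrix.det_transpose]
      congr 1
      ext i j
      change MvPolynomial.eval y₀ (P.jacobiMatrix j i) = _
      rw [P.jacobiMatrix_apply]
      rfl
    rw [h1, hφ₀, h2]
    exact hJ.map _
  let φ : A →ₐ[R] κ := IsLocalization.Away.liftAlgHom δ (f := φ₀) hδ
  have hprime : (RingHom.ker φ).IsPrime := RingHom.ker_isPrime φ
  have hat : Algebra.IsEtaleAt R (RingHom.ker φ) := inferInstance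
  -- Near this point the étale algebra is standard étale, generated up to localization by a root of
  -- one monic polynomial, so the one-variable Hensel property suffices.
  obtain ⟨f, hf, hB⟩ := Algebra.IsEtaleAt.exists_isStandardEtale (R := R) (S := A) (RingHom.ker φ)
  let B := Localization.Away f
  have hfφ : IsUnit (φ f) := isUnit_iff_ne_zero.2 fun h => hf h
  let φB : B →ₐ[R] κ := IsLocalization.Away.liftAlgHom f (f := φ) hfφ
  obtain ⟨E⟩ : Nonempty (StandardEtalePresentation R B) :=
    Algebra.IsStandardEtale.nonempty_standardEtalePresentation
  have hx : E.P.HasMap (φB E.x) := E.hasMap.map φB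
  have haeval (b : R) (g : R[X]) :
      aeval (IsLocalRing.residue R b) g = IsLocalRing.residue R (g.eval b) := by
    rw [← IsLocalRing.ResidueField.algebraMap_eq, aeval_algebraMap_apply, coe_aeval_eq_eval]
  obtain ⟨b, hb⟩ := IsLocalRing.residue_surjective (φB E.x)
  have hx' := hx.isUnit_derivative_f
  rw [← hb, haeval] at hx'
  obtain ⟨a, ha, hab⟩ := HenselianLocalRing.is_henselian E.f E.monic_f b
    ((IsLocalRing.residue_eq_zero_iff _).1 (by rw [← haeval, hb]; exact hx.1))
    (isUnit_of_map_unit (IsLocalRing.residue R) _ hx')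
  have hax : IsLocalRing.residue R a = φB E.x := by
    rw [← hb, ← sub_eq_zero, ← map_sub]
    exact (IsLocalRing.residue_eq_zero_iff _).2 hab
  have haE : E.P.HasMap a := by
    refine ⟨by simpa using ha, ?_⟩
    have h2 := hx.2
    rw [← hax, haeval] at h2
    exact isUnit_of_map_unit (IsLocalRing.residue R) _ h2
  let ψ : B →ₐ[R] R := (E.P.lift a haE).comp E.equivRing.toAlgHom
  have hψ : (Algebra.ofId R κ).comp ψ = φB := by
    refine E.hom_ext ?_
    have : ψ E.x = a := by simp [ψ]
    rw [AlgHom.comp_apply, this, ← hax]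
    rfl
  let χ : MvPolynomial σ R →ₐ[R] B := ((IsScalarTower.toAlgHom R A B).comp
    (IsScalarTower.toAlgHom R A₀ A)).comp (Ideal.Quotient.mkₐ R (Ideal.span (Set.range F)))
  have hy (g : MvPolynomial σ R) : MvPolynomial.eval (fun j => ψ (χ (MvPolynomial.X j))) g =
      ψ (χ g) := by
    rw [← MvPolynomial.coe_aeval_eq_eval, RingHom.coe_coe, ← AlgHom.comp_apply]
    congr 1
    ext j
    simp
  have hχ (g : MvPolynomial σ R) : φB (χ g) = IsLocalRing.residue R (MvPolynomial.eval y₀ g) := by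
    rw [← hφ₀]
    have h1 : φB (χ g) = φ (algebraMap A₀ A (Ideal.Quotient.mk _ g)) :=
      IsLocalization.Away.lift_eq f hfφ _
    rw [h1]
    exact IsLocalization.Away.lift_eq δ hδ _
  refine ⟨fun j => ψ (χ (MvPolynomial.X j)), fun i => ?_, fun j => ?_⟩
  · have h0 : Ideal.Quotient.mkₐ R (Ideal.span (Set.range F)) (F i) = 0 :=
      Ideal.Quotient.eq_zero_iff_mem.2 (Ideal.subset_span ⟨i, rfl⟩)
    rw [hy]
    simp only [χ, AlgHom.comp_apply, h0, map_zero]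
  · have h1 : IsLocalRing.residue R (ψ (χ (MvPolynomial.X j))) = φB (χ (MvPolynomial.X j)) :=
      DFunLike.congr_fun hψ _
    rw [← IsLocalRing.residue_eq_zero_iff, map_sub, h1, hχ, MvPolynomial.eval_X, sub_self]

theorem ValuationSubring.eval_map_subtype {F : Type*} [Field F] (V : ValuationSubring F) (f : V[X])
    (a : V) : (f.map V.subtype).eval (a : F) = (f.eval a : V) :=
  (eval_map _ _).trans (eval₂_at_apply V.subtype a)

/-- Valuation rings of algebraically closed fields are Henselian. -/
theorem ValuationSubring.henselianLocalRing {F : Type*} [Field F] [IsAlgClosed F]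
    (V : ValuationSubring F) : HenselianLocalRing V where
  is_henselian f hf a₀ h₁ _ := by
    have hsp := IsAlgClosed.splits (f.map V.subtype)
    -- Over an algebraically closed field `f(a₀)` is the product of the `a₀ - r` over the roots `r`.
    -- If it lies in the maximal ideal, some factor has valuation less than one, and that `r` is the
    -- required lift.
    have hval : ((f.map V.subtype).roots.map fun r => (a₀ : F) - r).prod = (f.eval a₀ : V) := by
      rw [← hsp.eval_eq_prod_roots_of_monic (hf.map _)]
      exact V.eval_map_subtype f a₀
    have hlt : V.valuation (f.eval a₀ : V) < 1 := (V.valuation_lt_one_iff _).1 h₁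
    obtain ⟨r, hr, hr1⟩ : ∃ r ∈ (f.map V.subtype).roots, V.valuation ((a₀ : F) - r) < 1 := by
      by_contra! hcon
      rw [← hval] at hlt
      refine hlt.not_ge (Multiset.prod_induction (fun y => 1 ≤ V.valuation y) _ ?_ (by simp) ?_)
      · intro y z hy hz
        rw [map_mul]
        exact one_le_mul hy hz
      · intro y hy
        obtain ⟨r, hr, rfl⟩ := Multiset.mem_map.1 hy
        exact hcon r hr
    have hrV : (a₀ : F) - r ∈ V := (V.valuation_le_one_iff _).1 hr1.le
    refine ⟨a₀ - ⟨_, hrV⟩, ?_, ?_⟩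
    · have h0 : ((f.eval (a₀ - ⟨_, hrV⟩) : V) : F) = 0 := by
        rw [← V.eval_map_subtype]
        simpa using isRoot_of_mem_roots hr
      exact (map_eq_zero_iff V.subtype V.subtype_injective).1 h0
    · rw [sub_sub_cancel_left, neg_mem_iff]
      exact (V.valuation_lt_one_iff _).2 hr1

end Hensel

/-! ### Deforming the power sum equations. -/

section DeformedPowerSums

/-- The inhomogeneous system of power sum equations `∑ w_j z_j ^ m = t ^ (N - m)` for
`1 ≤ m ≤ N`, where `N` is the number of unknowns. -/
def IsPowerSumSolution {ι R : Type*} [Fintype ι] [CommRing R] (w : ι → ℕ) (t : R) (z : ι → R) :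
    Prop :=
  ∀ m, 1 ≤ m → m ≤ Fintype.card ι → powerSum w m z = t ^ (Fintype.card ι - m)

theorem IsPowerSumSolution.map {ι R R' : Type*} [Fintype ι] [CommRing R] [CommRing R']
    {w : ι → ℕ} {t : R} {z : ι → R} (h : IsPowerSumSolution w t z) (f : R →+* R') :
    IsPowerSumSolution w (f t) fun j => f (z j) := fun m h1 h2 => by
  rw [← map_powerSum, h m h1 h2, map_pow]

theorem powerSum_perm {ι R : Type*} [Fintype ι] [CommRing R] {w : ι → ℕ} {π : Equiv.Perm ι}
    (hπ : ∀ j, w (π j) = w j) (m : ℕ) (z : ι → R) :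
    powerSum w m (fun j => z (π j)) = powerSum w m z := by
  rw [powerSum, powerSum, ← Equiv.sum_comp π fun j => (w j : R) * z j ^ m]
  exact Finset.sum_congr rfl fun j _ => by rw [hπ]

theorem starPoly_perm {ι R : Type*} [Fintype ι] [CommRing R] {w : ι → ℕ} {π : Equiv.Perm ι}
    (hπ : ∀ j, w (π j) = w j) (z : ι → R) : starPoly w (fun j => z (π j)) = starPoly w z := by
  rw [starPoly, starPoly, ← Equiv.prod_comp π fun j => (1 - C (z j) * X) ^ w j]
  exact Finset.prod_congr rfl fun j _ => by rw [hπ]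

section Field

variable {ι : Type} {k : Type*} [Fintype ι] [Field k] {w : ι → ℕ}

theorem IsPowerSumSolution.powerSum_eq_zero {u : ι → k} (h : IsPowerSumSolution w 0 u) (m : ℕ)
    (h1 : 1 ≤ m) (h2 : m < Fintype.card ι) : powerSum w m u = 0 := by
  rw [h m h1 h2.le, zero_pow (by omega)]

theorem IsPowerSumSolution.ne_zero [Nonempty ι] {u : ι → k} (h : IsPowerSumSolution w 0 u) :
    u ≠ 0 := by
  rintro rfl
  have h1 := h _ Fintype.card_pos le_rfl
  have h0 : powerSum w (Fintype.card ι) (0 : ι → k) = 0 :=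
    Finset.sum_eq_zero fun j _ => by simp
  rw [h0, Nat.sub_self, pow_zero] at h1
  exact zero_ne_one h1

theorem IsPowerSumSolution.injective [Nonempty ι] (hw : NonvanishingSubsums k w) {u : ι → k}
    (h : IsPowerSumSolution w 0 u) : Function.Injective u ∧ ∀ j, u j ≠ 0 :=
  injective_of_powerSum_eq_zero hw h.powerSum_eq_zero h.ne_zero

/-- The polynomial determines its zeros with multiplicities, hence the family up to a permutation
that preserves the weights. -/
theorem exists_perm_of_starPoly_eq (hw : ∀ j, 0 < w j) {x y : ι → k}
    (hx : Function.Injective x) (hx0 : ∀ j, x j ≠ 0) (hy : Function.Injective y)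
    (hy0 : ∀ j, y j ≠ 0) (h : starPoly w x = starPoly w y) :
    ∃ π : Equiv.Perm ι, (∀ j, w (π j) = w j) ∧ ∀ j, y j = x (π j) := by
  have hex (j : ι) : ∃ l, x l = y j := by
    have h0 : (starPoly w x).eval (y j)⁻¹ = 0 := by
      rw [h, starPoly_eval_eq_zero_iff hw]
      exact ⟨j, mul_inv_cancel₀ (hy0 j)⟩
    obtain ⟨l, hl⟩ := (starPoly_eval_eq_zero_iff hw _ _).1 h0
    exact ⟨l, (mul_inv_eq_one₀ (hy0 j)).1 hl⟩
  choose f hf using hex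
  have hinj : Function.Injective f := fun j l e => hy (by rw [← hf, ← hf, e])
  refine ⟨Equiv.ofBijective f (Finite.injective_iff_bijective.1 hinj), fun j => ?_,
    fun j => (hf j).symm⟩
  have h1 := rootMultiplicity_starPoly (w := w) hx hx0 (f j)
  rw [hf, h, rootMultiplicity_starPoly hy hy0] at h1
  exact h1.symm

/-- Pulling the weights out of the columns and the exponents out of the rows leaves a Vandermonde
determinant. The exponents run over `1, ..., N`, whence the tameness hypothesis. -/
theorem det_powerSum_jacobian_ne_zero [DecidableEq ι] (hw : NonvanishingSubsums k w)
    (htame : ∀ e, 1 ≤ e → e ≤ Fintype.card ι → (e : k) ≠ 0) (e : ι ≃ Fin (Fintype.card ι))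
    {u : ι → k} (hu : Function.Injective u) :
    (Matrix.of fun i j => (w j : k) * (((e i + 1 : ℕ) : k) * u j ^ (e i : ℕ))).det ≠ 0 := by
  have h1 := Matrix.det_mul_row (fun j => (w j : k))
    (Matrix.of fun i j => (((e i + 1 : ℕ) : k) * u j ^ (e i : ℕ)))
  have h2 := Matrix.det_mul_column (fun i => ((e i + 1 : ℕ) : k))
    (Matrix.of fun i j => u j ^ (e i : ℕ))
  have h3 : (Matrix.of fun i j => u j ^ (e i : ℕ)) =
      (Matrix.vandermonde fun i => u (e.symm i)).transpose.submatrix e e := by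
    ext i j
    simp [Matrix.vandermonde_apply]
  simp only [Matrix.of_apply] at h1 h2
  rw [h1, h2, h3, Matrix.det_submatrix_equiv_self, Matrix.det_transpose]
  refine mul_ne_zero (Finset.prod_ne_zero_iff.2 fun j _ => ?_)
    (mul_ne_zero (Finset.prod_ne_zero_iff.2 fun i _ => htame _ (by omega) (e i).2)
      (Matrix.det_vandermonde_ne_zero_iff.2 (hu.comp e.symm.injective)))
  simpa using hw {j} (Finset.singleton_nonempty j)

end Field

section Local

variable {ι : Type} {R : Type*} [Fintype ι] [CommRing R] [IsLocalRing R] {w : ι → ℕ}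

theorem IsPowerSumSolution.residue {t : R} (ht : t ∈ IsLocalRing.maximalIdeal R) {z : ι → R}
    (h : IsPowerSumSolution w t z) :
    IsPowerSumSolution w 0 fun j => IsLocalRing.residue R (z j) := by
  have := h.map (IsLocalRing.residue R)
  rwa [(IsLocalRing.residue_eq_zero_iff t).2 ht] at this

/-- A solution of the system of power sum equations is determined by its residue. -/
theorem IsPowerSumSolution.eq_of_sub_mem [Nonempty ι]
    (hw : NonvanishingSubsums (IsLocalRing.ResidueField R) w)
    (htame : ∀ e, 1 ≤ e → e ≤ Fintype.card ι → (e : IsLocalRing.ResidueField R) ≠ 0)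
    {t : R} (ht : t ∈ IsLocalRing.maximalIdeal R) {z y : ι → R} (hz : IsPowerSumSolution w t z)
    (hy : IsPowerSumSolution w t y) (h : ∀ j, z j - y j ∈ IsLocalRing.maximalIdeal R) : z = y := by
  classical
  let e := Fintype.equivFin ι
  -- Divided differences: `M` sends `z - y` to the differences of the power sums, which vanish.
  -- Since `z` and `y` agree in the residue field, `M` reduces to the invertible Jacobian.
  let M : Matrix ι ι R := Matrix.of fun i j =>
    (w j : R) * ∑ r ∈ Finset.range (e i + 1), z j ^ r * y j ^ (e i + 1 - 1 - r)
  have hres (j : ι) : IsLocalRing.residue R (y j) = IsLocalRing.residue R (z j) :=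
    (sub_eq_zero.1 (by rw [← map_sub]; exact (IsLocalRing.residue_eq_zero_iff _).2 (h j))).symm
  have hM : (IsLocalRing.residue R).mapMatrix M = Matrix.of fun i j =>
      (w j : IsLocalRing.ResidueField R) *
        (((e i + 1 : ℕ) : IsLocalRing.ResidueField R) * IsLocalRing.residue R (z j) ^ (e i : ℕ)) := by
    ext i j
    simp only [M, RingHom.mapMatrix_apply, Matrix.map_apply, Matrix.of_apply, map_mul, map_natCast,
      map_sum, map_pow, hres]
    congr 1
    rw [Finset.sum_congr rfl (g := fun _ => IsLocalRing.residue R (z j) ^ (e i : ℕ)) fun r hr => ?_,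
      Finset.sum_const, Finset.card_range, nsmul_eq_mul]
    rw [← pow_add]
    congr 1
    have := Finset.mem_range.1 hr
    omega
  have hdet : IsUnit M.det := by
    refine isUnit_of_map_unit (IsLocalRing.residue R) _ (isUnit_iff_ne_zero.2 ?_)
    rw [RingHom.map_det, hM]
    exact det_powerSum_jacobian_ne_zero hw htame e (hz.residue ht |>.injective hw).1
  have hker : M.mulVec (z - y) = M.mulVec 0 := by
    rw [Matrix.mulVec_zero]
    ext i
    have h1 : ∑ j, M i j * (z j - y j) = powerSum w (e i + 1) z - powerSum w (e i + 1) y := by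
      rw [powerSum, powerSum, ← Finset.sum_sub_distrib]
      refine Finset.sum_congr rfl fun j _ => ?_
      rw [← mul_sub, ← (Commute.all (z j) (y j)).geom_sum₂_mul, ← mul_assoc]
      rfl
    rw [hz _ (by omega) (e i).2, hy _ (by omega) (e i).2, sub_self] at h1
    exact h1
  have := Matrix.mulVec_injective_of_isUnit ((Matrix.isUnit_iff_isUnit_det M).2 hdet) hker
  exact sub_eq_zero.1 this

/-- Equal reduced polynomials match the residues up to a weight-preserving permutation. Permuting a
solution gives a solution with the same polynomial, so uniqueness for given residues applies. -/
theorem IsPowerSumSolution.starPoly_eq_of_residue_eq [Nonempty ι]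
    (hw : NonvanishingSubsums (IsLocalRing.ResidueField R) w)
    (htame : ∀ e, 1 ≤ e → e ≤ Fintype.card ι → (e : IsLocalRing.ResidueField R) ≠ 0)
    {t : R} (ht : t ∈ IsLocalRing.maximalIdeal R) {z y : ι → R} (hz : IsPowerSumSolution w t z)
    (hy : IsPowerSumSolution w t y)
    (h : (starPoly w z).map (IsLocalRing.residue R) = (starPoly w y).map (IsLocalRing.residue R)) :
    starPoly w z = starPoly w y := by
  rw [map_starPoly, map_starPoly] at h
  obtain ⟨hz1, hz0⟩ := (hz.residue ht).injective hw
  obtain ⟨hy1, hy0⟩ := (hy.residue ht).injective hw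
  obtain ⟨π, hπ, hzy⟩ := exists_perm_of_starPoly_eq hw.pos hz1 hz0 hy1 hy0 h
  have : y = fun j => z (π j) := by
    refine hy.eq_of_sub_mem hw htame ht (fun m h1 h2 => ?_) fun j => ?_
    · rw [powerSum_perm hπ, hz m h1 h2]
    · rw [← IsLocalRing.residue_eq_zero_iff, map_sub, sub_eq_zero]
      exact hzy j
  rw [this, starPoly_perm hπ]

end Local

/-- Over a Henselian local ring, solutions of the power sum equations can be moved along a
deformation of the parameter in the maximal ideal. -/
theorem IsPowerSumSolution.exists_deformation {ι : Type} {R : Type*} [Fintype ι] [Nonempty ι]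
    [CommRing R] [HenselianLocalRing R] {w : ι → ℕ}
    (hw : NonvanishingSubsums (IsLocalRing.ResidueField R) w)
    (htame : ∀ e, 1 ≤ e → e ≤ Fintype.card ι → (e : IsLocalRing.ResidueField R) ≠ 0)
    {t s : R} (ht : t ∈ IsLocalRing.maximalIdeal R) (hs : s ∈ IsLocalRing.maximalIdeal R)
    {z : ι → R} (hz : IsPowerSumSolution w t z) :
    ∃ y : ι → R, IsPowerSumSolution w s y ∧
      ∀ j, IsLocalRing.residue R (y j) = IsLocalRing.residue R (z j) := by
  classical
  let e := Fintype.equivFin ι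
  -- The equations are indexed by the unknowns through `e`; the shift turns the indices `0, ..., N -
  -- 1` into the exponents `1, ..., N`.
  let F : ι → MvPolynomial ι R := fun i =>
    ∑ j, MvPolynomial.C (w j : R) * MvPolynomial.X j ^ (e i + 1 : ℕ) -
      MvPolynomial.C (s ^ (Fintype.card ι - (e i + 1)))
  have hF (i : ι) (y : ι → R) : MvPolynomial.eval y (F i) =
      powerSum w (e i + 1) y - s ^ (Fintype.card ι - (e i + 1)) := by
    simp [F, powerSum]
  have hdF (i j : ι) : MvPolynomial.eval z (MvPolynomial.pderiv j (F i)) =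
      (w j : R) * (((e i + 1 : ℕ) : R) * z j ^ (e i : ℕ)) := by
    simp only [F, map_sub, map_sum, MvPolynomial.pderiv_C, sub_zero, MvPolynomial.pderiv_C_mul,
      MvPolynomial.pderiv_pow, MvPolynomial.pderiv_X]
    rw [Finset.sum_eq_single j]
    · simp
    · intro l _ hl
      simp [Pi.single_eq_of_ne hl]
    · simp
  have hres := hz.residue ht
  obtain ⟨y, hy, hyz⟩ := HenselianLocalRing.exists_lift_of_isUnit_jacobian F z (fun i => by
      rw [hF, ← IsLocalRing.residue_eq_zero_iff, map_sub, map_powerSum, map_pow,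
        (IsLocalRing.residue_eq_zero_iff s).2 hs, hres _ (by omega) (e i).2, sub_self]) (by
      refine isUnit_of_map_unit (IsLocalRing.residue R) _ (isUnit_iff_ne_zero.2 ?_)
      have hM : (IsLocalRing.residue R).mapMatrix
          (Matrix.of fun i j => MvPolynomial.eval z (MvPolynomial.pderiv j (F i))) =
          Matrix.of fun i j => (w j : IsLocalRing.ResidueField R) *
            (((e i + 1 : ℕ) : IsLocalRing.ResidueField R) *
              IsLocalRing.residue R (z j) ^ (e i : ℕ)) := by
        ext i j
        simp only [RingHom.mapMatrix_apply, Matrix.map_apply, Matrix.of_apply, hdF, map_mul,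
          map_natCast, map_pow]
      rw [RingHom.map_det, hM]
      exact det_powerSum_jacobian_ne_zero hw htame e (hres.injective hw).1)
  refine ⟨y, fun m h1 h2 => ?_, fun j => ?_⟩
  · have := hy (e.symm ⟨m - 1, by omega⟩)
    rw [hF, sub_eq_zero] at this
    simpa [Nat.sub_add_cancel h1] using this
  · rw [← sub_eq_zero, ← map_sub]
    exact (IsLocalRing.residue_eq_zero_iff _).2 (hyz j)

end DeformedPowerSums

/-! ### Integrality from power sums. -/

section Integrality

variable {ι : Type} {F : Type*} [Fintype ι] [Field F] (A : ValuationSubring F) {w : ι → ℕ}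

/-- Dividing by an entry of largest valuation makes the family integral with nonzero reduction. -/
theorem ValuationSubring.exists_scaling {u : ι → F} (hu : u ≠ 0) :
    ∃ c : F, c ≠ 0 ∧ ∃ v : ι → A, (∃ j, v j = 1) ∧ ∀ j, u j = c * v j := by
  obtain ⟨j₁, hj₁⟩ := Function.ne_iff.1 hu
  obtain ⟨j₀, -, hmax⟩ := Finset.exists_max_image Finset.univ (fun j => A.valuation (u j))
    ⟨j₁, Finset.mem_univ _⟩
  have h0 : u j₀ ≠ 0 := fun h => by
    have := hmax j₁ (Finset.mem_univ _)
    rw [h, map_zero, le_zero_iff, map_eq_zero] at this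
    exact hj₁ this
  have hmem (j : ι) : u j / u j₀ ∈ A := by
    rw [← A.valuation_le_one_iff, map_div₀]
    exact div_le_one_of_le₀ (hmax j (Finset.mem_univ _)) zero_le
  refine ⟨u j₀, h0, fun j => ⟨_, hmem j⟩, ⟨j₀, Subtype.ext (div_self h0)⟩, fun j => ?_⟩
  exact (mul_div_cancel₀ _ h0).symm

theorem residue_eq_zero_of_not_mem {c : F} (hc : c ∉ A) {m : ℕ} (hm : 1 ≤ m) {b : A}
    (hb : c ^ m * b ∈ A) : IsLocalRing.residue A b = 0 := by
  rw [IsLocalRing.residue_eq_zero_iff, A.valuation_lt_one_iff]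
  rw [← A.valuation_le_one_iff, not_le] at hc
  rw [← A.valuation_le_one_iff, map_mul, map_pow] at hb
  by_contra! hb1
  exact absurd hb (not_le.2 ((one_lt_pow₀ hc (by omega)).trans_le (le_mul_of_one_le_right' hb1)))

/-- A family whose first power sums are integral is integral. -/
theorem ValuationSubring.mem_of_powerSum_mem
    (hw : NonvanishingSubsums (IsLocalRing.ResidueField A) w) {u : ι → F}
    (h : ∀ m, 1 ≤ m → m ≤ Fintype.card ι → powerSum w m u ∈ A) (j : ι) : u j ∈ A := by
  by_cases hu : u = 0
  · rw [hu]
    exact A.zero_mem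
  obtain ⟨c, -, v, ⟨j₀, hj₀⟩, huv⟩ := A.exists_scaling hu
  by_cases hc : c ∈ A
  · rw [huv]
    exact A.mul_mem _ _ hc (v j).2
  · have hzero := eq_zero_of_powerSum_eq_zero hw (x := fun j => IsLocalRing.residue A (v j))
      fun m h1 h2 => by
        have h3 := h m h1 h2
        rw [show u = fun j => c * A.subtype (v j) from funext huv, powerSum_mul,
          ← map_powerSum] at h3
        rw [← map_powerSum]
        exact residue_eq_zero_of_not_mem A hc h1 h3
    have := congrFun hzero j₀
    simp [hj₀] at this

/-- Scale to `u = c v` with `v` integral of nonzero reduction. The vanishing power sums then make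
every entry of `v` a unit, and `c` is the inverse of the entry `v j₁`. -/
theorem ValuationSubring.mem_of_powerSum_eq_zero
    (hw : NonvanishingSubsums (IsLocalRing.ResidueField A) w) {u : ι → F}
    (h : ∀ m, 1 ≤ m → m < Fintype.card ι → powerSum w m u = 0) {j₁ : ι} (hj₁ : u j₁ = 1) (j : ι) :
    u j ∈ A := by
  obtain ⟨c, hc0, v, ⟨j₀, hj₀⟩, huv⟩ := A.exists_scaling (u := u) fun h => by simp [h] at hj₁
  have hne := (injective_of_powerSum_eq_zero hw (x := fun j => IsLocalRing.residue A (v j))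
    (fun m h1 h2 => by
      have h3 := h m h1 h2
      rw [show u = fun j => c * A.subtype (v j) from funext huv, powerSum_mul,
        ← map_powerSum, mul_eq_zero, or_iff_right (pow_ne_zero _ hc0),
        map_eq_zero_iff _ A.subtype_injective] at h3
      rw [← map_powerSum, h3, map_zero])
    fun h0 => by simpa [hj₀] using congrFun h0 j₀).2 j₁
  obtain ⟨b, hb⟩ := isUnit_iff_exists_inv'.1
    (isUnit_of_map_unit (IsLocalRing.residue A) (v j₁) (isUnit_iff_ne_zero.2 hne))
  have hcb : c = b := by
    have hb' : (b : F) * v j₁ = 1 := congrArg A.subtype hb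
    have h1 : c * v j₁ = 1 := by rw [← huv, hj₁]
    exact mul_right_cancel₀ (right_ne_zero_of_mul_eq_one h1) (h1.trans hb'.symm)
  rw [huv, hcb]
  exact (b * v j).2

end Integrality

/-! ### Regular primes, extension of valuation rings, decomposition groups. -/

section Arithmetic

theorem natCast_ne_zero_of_not_dvd {k : Type*} [Field k] {p : ℕ} (hp : p.Prime) (h0 : (p : k) = 0)
    {s : ℕ} (hs : ¬ p ∣ s) : (s : k) ≠ 0 := fun h => by
  obtain ⟨u, v, huv⟩ := (Nat.isCoprime_iff_coprime.2 ((Nat.Prime.coprime_iff_not_dvd hp).2 hs))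
  have := congrArg (Int.cast : ℤ → k) huv
  simp [h0, h] at this

theorem natCast_ne_zero_of_lt {k : Type*} [Field k] {p : ℕ} (hp : p.Prime) (h0 : (p : k) = 0)
    {e : ℕ} (h1 : 1 ≤ e) (h2 : e < p) : (e : k) ≠ 0 :=
  natCast_ne_zero_of_not_dvd hp h0 fun h => absurd (Nat.le_of_dvd h1 h) (not_le.2 h2)

theorem IsRegularPrime.nonvanishingSubsums {ι : Type} [Fintype ι] [DecidableEq ι] {a : ι → ℕ}
    {i : ι} {p : ℕ} (hp : IsRegularPrime a i p) {k : Type*} [Field k] (h0 : (p : k) = 0) :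
    NonvanishingSubsums k (omitEntry a i) := fun S hS =>
  natCast_ne_zero_of_not_dvd hp.1 h0 fun h => hp.2.2 <|
    h.trans (Finset.dvd_prod_of_mem (fun S : Finset {j // j ≠ i} => ∑ j ∈ S, omitEntry a i j)
      (by simpa using hS))

/-- A valuation ring of `L` dominating the image of `A` cannot contain the image of any `z ∉ A`:
otherwise `z⁻¹`, a nonunit of `A`, would become a unit. -/
theorem exists_valuationSubring_extending {K L : Type*} [Field K] [Field L] (f : K →+* L)
    (A : ValuationSubring K) : ∃ V : ValuationSubring L, ∀ z : K, f z ∈ V ↔ z ∈ A := by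
  obtain ⟨V, hV, hloc⟩ := IsLocalRing.exists_factor_valuationRing (f.comp A.subtype)
  have hV' (z : K) (hz : z ∈ A) : f z ∈ V := hV ⟨z, hz⟩
  refine ⟨V, fun z => ⟨fun hz => ?_, hV' z⟩⟩
  rcases A.mem_or_inv_mem z with h | h
  · exact h
  by_cases hz0 : z = 0
  · rw [hz0]
    exact A.zero_mem
  have hu : IsUnit (⟨z⁻¹, h⟩ : A) := by
    refine hloc.map_nonunit _ (isUnit_iff_exists_inv.2 ⟨⟨f z, hz⟩, Subtype.ext ?_⟩)
    change f z⁻¹ * f z = 1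
    rw [← map_mul, inv_mul_cancel₀ hz0, map_one]
  obtain ⟨b, hb⟩ := isUnit_iff_exists_inv.1 hu
  have : z = b := by
    have hb' : z⁻¹ * (b : K) = 1 := congrArg A.subtype hb
    exact ((inv_mul_eq_one₀ hz0).1 hb')
  rw [this]
  exact b.2

/-- Expressing the maximal ideal through membership in the ring alone lets it be compared between
valuation rings with different value groups. -/
theorem ValuationSubring.valuation_lt_one_iff_inv_not_mem {F : Type*} [Field F]
    (V : ValuationSubring F) (z : F) : V.valuation z < 1 ↔ z = 0 ∨ z⁻¹ ∉ V := by
  by_cases hz : z = 0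
  · simp [hz]
  · rw [or_iff_right hz, ← V.valuation_le_one_iff, map_inv₀, not_le,
      one_lt_inv₀ (by simpa [zero_lt_iff] using hz)]

/-- If `x⁻¹` is integral, it divides `f(x⁻¹) - f(0) = -1`, so it is a unit. -/
theorem ValuationSubring.mem_of_eval_inv_eq_zero {F : Type*} [Field F] (A : ValuationSubring F)
    {f : A[X]} (hf : f.eval 0 = 1) {x : F} (hx : (f.map A.subtype).eval x⁻¹ = 0) : x ∈ A := by
  rcases A.mem_or_inv_mem x with h | h
  · exact h
  have h0 : f.eval ⟨x⁻¹, h⟩ = 0 := by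
    rw [← map_eq_zero_iff _ A.subtype_injective]
    exact (A.eval_map_subtype f ⟨x⁻¹, h⟩).symm.trans hx
  obtain ⟨c, hc⟩ := sub_dvd_eval_sub (⟨x⁻¹, h⟩ : A) 0 f
  rw [h0, hf, sub_zero] at hc
  have hc' : (0 : F) - 1 = x⁻¹ * c := congrArg A.subtype hc
  have hx0 : x ≠ 0 := by
    rintro rfl
    simp at hc'
  have : x = ((-c : A) : F) := by
    have h2 : x * (0 - 1) = c := by rw [hc', mul_inv_cancel_left₀ hx0]
    push_cast
    rw [← h2]
    ring
  rw [this]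
  exact (-c).2

variable {F : Type*} [Field F] [NumberField F]

theorem decompositionGroup_apply_mem {𝔭 : HeightOneSpectrum (𝓞 F)} {τ : F ≃ₐ[ℚ] F}
    (hτ : τ ∈ decompositionGroup 𝔭) {z : F} (hz : z ∈ localRingAt 𝔭) : τ z ∈ localRingAt 𝔭 := by
  obtain ⟨r, d, h⟩ := 𝔭.exists_primeCompl_mul_eq_of_integer z hz
  have h' : τ z * algebraMap (𝓞 F) F (τ • (d : 𝓞 F)) = algebraMap (𝓞 F) F (τ • r) := by
    have := congrArg τ h
    rwa [map_mul] at this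
  have hd : τ • (d : 𝓞 F) ∉ 𝔭.asIdeal := fun hmem => by
    have hmem' : τ • (d : 𝓞 F) ∈ τ • 𝔭.asIdeal :=
      (MulAction.mem_stabilizer_iff.1 hτ).symm ▸ hmem
    exact d.2 (Ideal.smul_mem_pointwise_smul_iff.1 hmem')
  have hv : 𝔭.valuation F (algebraMap (𝓞 F) F (τ • (d : 𝓞 F))) = 1 := by
    rw [𝔭.valuation_eq_one_iff_notMem]
    exact hd
  have hle : 𝔭.valuation F (algebraMap (𝓞 F) F (τ • r)) ≤ 1 := 𝔭.valuation_le_one _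
  rw [← h', map_mul, hv, mul_one] at hle
  exact hle

theorem natCast_residueFieldAt_eq_zero {𝔭 : HeightOneSpectrum (𝓞 F)} {p : ℕ}
    (h : (p : 𝓞 F) ∈ 𝔭.asIdeal) : (p : residueFieldAt 𝔭) = 0 := by
  have h1 : 𝔭.valuation F (algebraMap (𝓞 F) F (p : 𝓞 F)) < 1 :=
    (𝔭.valuation_lt_one_iff_mem _).2 h
  rw [map_natCast] at h1
  have h2 : (localRingAt 𝔭).valuation (p : F) < 1 := by
    rw [ValuationSubring.valuation_lt_one_iff_inv_not_mem]
    refine or_iff_not_imp_left.2 fun hp hmem => ?_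
    have h3 : 𝔭.valuation F (p : F)⁻¹ ≤ 1 := hmem
    rw [map_inv₀, inv_le_one₀ (by simpa [zero_lt_iff] using hp)] at h3
    exact absurd h1 (not_lt.2 h3)
  rw [← map_natCast (IsLocalRing.residue (localRingAt 𝔭)), IsLocalRing.residue_eq_zero_iff,
    ValuationSubring.valuation_lt_one_iff]
  simpa using h2

end Arithmetic

/-! ### Fields of definition and the equations of Kummer models. -/

section SplittingFields

theorem mem_valencySplittingField {ι : Type} {a : ι → ℕ} {β : QBar[X]} (h : IsNormalizedModel a β) {z : QBar}
    (hz : β.eval z = 0) : z ∈ valencySplittingField a :=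
  (le_iSup (fun T : DiameterFourTree QBar a => T.splittingField)
    (Quotient.mk (modelSetoid QBar a) ⟨β, h.1.1⟩))
    (IntermediateField.subset_adjoin ℚ _ ⟨β, ⟨h.1.1, rfl⟩, h, hz⟩)

variable {ι : Type} [Fintype ι] {a : ι → ℕ}

theorem coeff_mem_valencyKummerField {β : QBar[X]} (h : IsKummerModel a β) (m : ℕ) :
    β.coeff m ∈ valencyKummerField a :=
  (le_iSup (fun T : DiameterFourTree QBar a => T.kummerField)
    (Quotient.mk (modelSetoid QBar a) ⟨β, h.1.1⟩))
    (IntermediateField.subset_adjoin ℚ _ ⟨β, ⟨h.1.1, rfl⟩, h, m, rfl⟩)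

/-- Kummer models correspond to the solutions of the undeformed system of power sum equations. -/
theorem isKummerModel_iff {k : Type*} [Field k] [IsAlgClosed k] [CharZero k] [Nonempty ι]
    (ha : ∀ j, 0 < a j) {β : k[X]} :
    IsKummerModel a β ↔ ∃ y, IsPowerSumSolution a 0 y ∧ β = starPoly a y := by
  constructor
  · rintro ⟨h, y, hβ, hy⟩
    refine ⟨y, fun m h1 h2 => ?_, hβ⟩
    rcases h2.lt_or_eq with h2 | rfl
    · rw [zero_pow (by omega)]
      subst hβ
      exact IsStandardModel.powerSum_eq_zero h h1 h2
    · rw [Nat.sub_self, pow_zero]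
      exact hy
  · rintro ⟨y, hy, rfl⟩
    refine ⟨isStandardModel_starPoly (nonvanishingSubsums_of_pos ha)
      (fun e h1 _ => Nat.cast_ne_zero.2 (by omega)) hy.powerSum_eq_zero hy.ne_zero, y, rfl, ?_⟩
    have := hy _ Fintype.card_pos le_rfl
    rwa [Nat.sub_self, pow_zero] at this

end SplittingFields

/-! ### Separating the entry of index `i`. -/

section Insertion

variable {ι : Type} [DecidableEq ι] {R : Type*} [CommRing R]

/-- The family obtained from `z` by inserting the entry `1` at `i`. -/
def insertOne (i : ι) (z : {j // j ≠ i} → R) : ι → R :=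
  fun j => if h : j = i then 1 else z ⟨j, h⟩

theorem insertOne_self (i : ι) (z : {j // j ≠ i} → R) : insertOne i z i = 1 := dif_pos rfl

theorem insertOne_of_ne (i : ι) (z : {j // j ≠ i} → R) (j : {j // j ≠ i}) :
    insertOne i z j = z j := dif_neg j.2

theorem starPoly_eq_mul_omitEntry [Fintype ι] (a : ι → ℕ) (i : ι) (x : ι → R) :
    starPoly a x = (1 - C (x i) * X) ^ a i * starPoly (omitEntry a i) fun j => x j :=
  Fintype.prod_eq_mul_prod_subtype_ne (fun j => (1 - C (x j) * X) ^ a j) i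

theorem powerSum_eq_add_omitEntry [Fintype ι] (a : ι → ℕ) (i : ι) (m : ℕ) (x : ι → R) :
    powerSum a m x = (a i : R) * x i ^ m + powerSum (omitEntry a i) m fun j => x j :=
  Fintype.sum_eq_add_sum_subtype_ne (fun j => (a j : R) * x j ^ m) i

end Insertion

/-! ### The correspondence between canonical and Kummer models. -/

section Correspondence

/-- A relation that is total and injective in both directions is the graph of a bijection. -/
theorem exists_equiv_of_rel {α β : Type*} {r : α → β → Prop} (h₁ : ∀ x, ∃ y, r x y)
    (h₂ : ∀ y, ∃ x, r x y) (h₃ : ∀ {x y y'}, r x y → r x y' → y = y')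
    (h₄ : ∀ {x x' y}, r x y → r x' y → x = x') : ∃ Φ : α ≃ β, ∀ x, r x (Φ x) := by
  choose f hf using h₁
  refine ⟨Equiv.ofBijective f ⟨fun x x' h => h₄ (hf x) (h ▸ hf x'), fun y => ?_⟩, hf⟩
  obtain ⟨x, hx⟩ := h₂ y
  exact ⟨x, h₃ (hf x) hx⟩

/-- The polynomial `(1 - X) ^ a_i * g(ρX)`. -/
noncomputable def deformedModel {ι R : Type*} [CommRing R] (a : ι → ℕ) (i : ι) (ρ : R) (g : R[X]) :
    R[X] :=
  (1 - X) ^ a i * g.comp (C ρ * X)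

theorem deformedModel_injective {ι R : Type*} [CommRing R] [IsDomain R] (a : ι → ℕ) (i : ι) {ρ : R}
    (hρ : ρ ≠ 0) : Function.Injective (deformedModel a i ρ) := fun g h e => by
  have h1 : (1 - X : R[X]) ^ a i ≠ 0 := pow_ne_zero _ fun h => by
    have := congrArg (eval 0) h
    simp at this
  have h2 := mul_left_cancel₀ h1 e
  ext m
  have := congrArg (fun f => coeff f m) h2
  simp only [comp_C_mul_X_coeff] at this
  exact mul_right_cancel₀ (pow_ne_zero m hρ) this

theorem starPoly_insertOne {ι : Type} {R : Type*} [Fintype ι] [DecidableEq ι] [CommRing R] (a : ι → ℕ)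
    (i : ι) (z : {j // j ≠ i} → R) :
    starPoly a (insertOne i z) = (1 - X) ^ a i * starPoly (omitEntry a i) z := by
  rw [starPoly_eq_mul_omitEntry a i, insertOne_self, C_1, one_mul]
  simp only [insertOne_of_ne]

theorem deformedModel_starPoly {ι : Type} {R : Type*} [Fintype ι] [DecidableEq ι] [CommRing R]
    (a : ι → ℕ) (i : ι) (ρ : R) (z : {j // j ≠ i} → R) :
    deformedModel a i ρ (starPoly (omitEntry a i) z) =
      starPoly a (insertOne i fun j => ρ * z j) := by
  rw [starPoly_insertOne, ← starPoly_comp]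
  rfl

variable {ι : Type} [Fintype ι] [DecidableEq ι]

theorem card_eq_card_ne_add_one (i : ι) : Fintype.card ι = Fintype.card {j // j ≠ i} + 1 := by
  have h : Fintype.card {j // j ≠ i} = Fintype.card ι - 1 := Set.card_ne_eq i
  have : 0 < Fintype.card ι := Fintype.card_pos_iff.2 ⟨i⟩
  omega

/-- A valuation ring `V` of `ℚ̄` above the local ring at the prime `𝔭` of `K` at which `a i` is
zero and the sums of the other entries are units, together with a root `ρ ∈ K` of
`X ^ (n - 1) + a i`. -/
structure IsDegenerationPlace (a : ι → ℕ) (i : ι) {K : IntermediateField ℚ QBar} [NumberField K]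
    (𝔭 : HeightOneSpectrum (𝓞 K)) (V : ValuationSubring QBar) (ρ : V) : Prop where
  pos : ∀ j, 0 < a j
  nonempty : Nonempty {j // j ≠ i}
  subsums : NonvanishingSubsums (IsLocalRing.ResidueField V) (omitEntry a i)
  tame : ∀ e, 1 ≤ e → e ≤ Fintype.card {j // j ≠ i} → (e : IsLocalRing.ResidueField V) ≠ 0
  cast_eq_zero : (a i : IsLocalRing.ResidueField V) = 0
  mem_iff : ∀ z : K, (z : QBar) ∈ V ↔ z ∈ localRingAt 𝔭
  splittingField_le : valencySplittingField a ≤ K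
  kummerField_le : valencyKummerField (omitEntry a i) ≤ K
  pow_card : ρ ^ Fintype.card {j // j ≠ i} = -(a i : V)
  root_mem : (ρ : QBar) ∈ K

namespace IsDegenerationPlace

variable {a : ι → ℕ} {i : ι} {K : IntermediateField ℚ QBar} [NumberField K]
  {𝔭 : HeightOneSpectrum (𝓞 K)} {V : ValuationSubring QBar} {ρ : V}
  (H : IsDegenerationPlace a i 𝔭 V ρ)

include H

theorem card_pos : 0 < Fintype.card {j // j ≠ i} :=
  have := H.nonempty
  Fintype.card_pos

theorem root_ne_zero : ρ ≠ 0 := by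
  rintro rfl
  have h := H.pow_card
  rw [zero_pow H.card_pos.ne', eq_comm, neg_eq_zero, Nat.cast_eq_zero] at h
  exact (H.pos i).ne' h

theorem root_mem_maximalIdeal : ρ ∈ IsLocalRing.maximalIdeal V := by
  rw [← IsLocalRing.residue_eq_zero_iff, ← pow_eq_zero_iff H.card_pos.ne', ← map_pow, H.pow_card,
    map_neg, map_natCast, H.cast_eq_zero, neg_zero]

theorem omitEntry_pos (j : {j // j ≠ i}) : 0 < omitEntry a i j := H.pos j

/-- The inserted entry contributes `a i`, and the rescaled others contribute `ρ ^ m · ρ ^ (n - 1 -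
m) = -a i`. -/
theorem powerSum_insertOne {z : {j // j ≠ i} → V} (hz : IsPowerSumSolution (omitEntry a i) ρ z)
    {m : ℕ} (h1 : 1 ≤ m) (h2 : m < Fintype.card ι) :
    powerSum a m (insertOne i fun j => ρ * z j) = 0 := by
  have hm : m ≤ Fintype.card {j // j ≠ i} := by
    have := card_eq_card_ne_add_one i
    omega
  rw [powerSum_eq_add_omitEntry a i, insertOne_self, one_pow, mul_one]
  simp only [insertOne_of_ne]
  rw [powerSum_mul, hz m h1 hm, ← pow_add, Nat.add_sub_cancel' hm, H.pow_card, add_neg_cancel]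

theorem isNormalizedModel_deformedModel {z : {j // j ≠ i} → V}
    (hz : IsPowerSumSolution (omitEntry a i) ρ z) :
    IsNormalizedModel a ((deformedModel a i ρ (starPoly (omitEntry a i) z)).map V.subtype) := by
  have : Nonempty ι := ⟨i⟩
  rw [deformedModel_starPoly, map_starPoly]
  refine ⟨isStandardModel_starPoly (nonvanishingSubsums_of_pos H.pos)
    (fun e h1 _ => Nat.cast_ne_zero.2 (by omega)) (fun m h1 h2 => ?_) fun h0 => ?_, ?_⟩
  · rw [← map_powerSum, H.powerSum_insertOne hz h1 h2, map_zero]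
  · have := congrFun h0 i
    simp [insertOne_self] at this
  · rw [starPoly_eval_eq_zero_iff H.pos]
    exact ⟨i, by simp [insertOne_self]⟩

theorem inverse_zero_mem {x : ι → QBar} (hx : IsNormalizedModel a (starPoly a x)) (j : ι) :
    x j ∈ K := by
  have hj := hx.1.1.injective_of_eq_starPoly.2 j
  rw [← inv_inv (x j)]
  exact K.inv_mem (H.splittingField_le (mem_valencySplittingField hx
    ((starPoly_eval_eq_zero_iff H.pos _ _).2 ⟨j, mul_inv_cancel₀ hj⟩)))

theorem deformedModel_mem_canonicalModels {z : {j // j ≠ i} → V}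
    (hz : IsPowerSumSolution (omitEntry a i) ρ z) :
    (deformedModel a i ρ (starPoly (omitEntry a i) z)).map V.subtype ∈ canonicalModels 𝔭 a := by
  have h := H.isNormalizedModel_deformedModel hz
  refine ⟨h, ?_⟩
  rw [deformedModel_starPoly, map_starPoly] at h ⊢
  have hK := H.inverse_zero_mem h
  refine ⟨starPoly a fun j => ⟨⟨_, hK j⟩, (H.mem_iff _).1 (insertOne i (fun j => ρ * z j) j).2⟩, ?_⟩
  rw [toQBar, map_starPoly]
  rfl

theorem solution_mem {z : {j // j ≠ i} → V} (hz : IsPowerSumSolution (omitEntry a i) ρ z)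
    (j : {j // j ≠ i}) : (z j : QBar) ∈ K := by
  have h := H.isNormalizedModel_deformedModel hz
  rw [deformedModel_starPoly, map_starPoly] at h
  have hK := H.inverse_zero_mem h j
  rw [insertOne_of_ne] at hK
  have h2 := K.mul_mem (K.inv_mem H.root_mem) hK
  have h0 : (ρ : QBar) ≠ 0 := fun h => H.root_ne_zero (Subtype.ext h)
  have h3 : V.subtype (ρ * z j) = ρ * z j := rfl
  rwa [h3, inv_mul_cancel_left₀ h0] at h2

/-- The canonical models degenerate: all the inverse zeros but the one of index `i` reduce
to zero. -/
theorem exists_solution_of_mem_canonicalModels {β : QBar[X]} (hβ : β ∈ canonicalModels 𝔭 a) :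
    ∃ z : {j // j ≠ i} → V, IsPowerSumSolution (omitEntry a i) ρ z ∧
      β = (deformedModel a i ρ (starPoly (omitEntry a i) z)).map V.subtype := by
  obtain ⟨hβ, β₀, rfl⟩ := hβ
  obtain ⟨x, hx⟩ := hβ.1.1.exists_eq_starPoly hβ.1.2.1
  -- The constant term `1` makes the inverse zeros integral, although the leading coefficient need
  -- not be a unit.
  have hβ₀ : β₀.eval 0 = 1 := by
    have h0 := hβ.1.2.1
    rw [toQBar, ← coeff_zero_eq_eval_zero, coeff_map, coeff_zero_eq_eval_zero] at h0
    have hinj : Function.Injective ((algebraMap K QBar).comp (localRingAt 𝔭).subtype) :=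
      (algebraMap K QBar).injective.comp (localRingAt 𝔭).subtype_injective
    exact (map_eq_one_iff _ hinj).1 h0
  have hn : IsNormalizedModel a (starPoly a x) := hx ▸ hβ
  have hx0 := hn.1.1.injective_of_eq_starPoly.2
  have hK := H.inverse_zero_mem hn
  have hV (j : ι) : x j ∈ V := by
    rw [show x j = ((⟨x j, hK j⟩ : K) : QBar) from rfl, H.mem_iff]
    refine (localRingAt 𝔭).mem_of_eval_inv_eq_zero hβ₀ ?_
    apply (algebraMap K QBar).injective
    rw [map_zero, ← eval_map_apply, map_map]
    have : (starPoly a x).eval (x j)⁻¹ = 0 :=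
      (starPoly_eval_eq_zero_iff H.pos _ _).2 ⟨j, mul_inv_cancel₀ (hx0 j)⟩
    rw [← hx] at this
    exact this
  have hsum {m : ℕ} (h1 : 1 ≤ m) (h2 : m ≤ Fintype.card {j // j ≠ i}) : powerSum a m x = 0 :=
    hn.1.powerSum_eq_zero h1 (by rw [card_eq_card_ne_add_one i]; omega)
  let y : ι → V := fun j => ⟨x j, hV j⟩
  have hysum {m : ℕ} (h1 : 1 ≤ m) (h2 : m ≤ Fintype.card {j // j ≠ i}) : powerSum a m y = 0 := by
    rw [← map_eq_zero_iff _ V.subtype_injective, map_powerSum]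
    exact hsum h1 h2
  -- In the residue field `a i` vanishes, leaving `n - 1` vanishing power sums in the `n - 1` other
  -- entries.
  have hres : (fun j : {j // j ≠ i} => IsLocalRing.residue V (y j)) = 0 :=
    eq_zero_of_powerSum_eq_zero H.subsums fun m h1 h2 => by
      have := congrArg (IsLocalRing.residue V) (hysum h1 h2)
      rw [powerSum_eq_add_omitEntry a i, map_add, map_mul, map_natCast, H.cast_eq_zero, zero_mul,
        zero_add, map_zero, map_powerSum] at this
      exact this
  -- Some inverse zero equals `1`; only the one of index `i` does not reduce to `0`.
  have hi : x i = 1 := by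
    obtain ⟨j, hj⟩ := (starPoly_eval_eq_zero_iff H.pos _ _).1 hn.2
    rw [mul_one] at hj
    by_cases hji : j = i
    · rw [← hji, hj]
    · have h1 : y j = 1 := Subtype.ext hj
      have := congrFun hres ⟨j, hji⟩
      simp [h1] at this
  have hρ0 : (ρ : QBar) ≠ 0 := fun h => H.root_ne_zero (Subtype.ext h)
  have hρN : (ρ : QBar) ^ Fintype.card {j // j ≠ i} = -(a i : QBar) := by
    have := congrArg V.subtype H.pow_card
    simpa using this
  have hz (m : ℕ) (h1 : 1 ≤ m) (h2 : m ≤ Fintype.card {j // j ≠ i}) :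
      powerSum (omitEntry a i) m (fun j => (ρ : QBar)⁻¹ * x j) =
        (ρ : QBar) ^ (Fintype.card {j // j ≠ i} - m) := by
    have h := hsum h1 h2
    rw [powerSum_eq_add_omitEntry a i, hi, one_pow, mul_one, add_comm, add_eq_zero_iff_eq_neg,
      ← hρN] at h
    rw [powerSum_mul, h, inv_pow, pow_sub₀ _ hρ0 h2, mul_comm]
  -- Vanishing of the reductions does not by itself give divisibility by `ρ`; it follows from the
  -- integrality of the power sums of the quotients.
  have hzV (j : {j // j ≠ i}) : (ρ : QBar)⁻¹ * x j ∈ V :=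
    V.mem_of_powerSum_mem H.subsums (u := fun j : {j // j ≠ i} => (ρ : QBar)⁻¹ * x j)
      (fun m h1 h2 => by rw [hz m h1 h2]; exact (ρ ^ _ : V).2) j
  refine ⟨fun j => ⟨_, hzV j⟩, fun m h1 h2 => ?_, ?_⟩
  · apply V.subtype_injective
    rw [map_powerSum, map_pow]
    exact hz m h1 h2
  · rw [hx, deformedModel_starPoly, map_starPoly]
    congr 1
    ext j
    by_cases hji : j = i
    · rw [hji, insertOne_self, map_one, hi]
    · rw [insertOne_of_ne i _ ⟨j, hji⟩]
      exact (mul_inv_cancel_left₀ hρ0 _).symm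

theorem exists_solution_of_isKummerModel {γ : QBar[X]} (hγ : IsKummerModel (omitEntry a i) γ) :
    ∃ y : {j // j ≠ i} → V, IsPowerSumSolution (omitEntry a i) 0 y ∧
      γ = (starPoly (omitEntry a i) y).map V.subtype := by
  have := H.nonempty
  obtain ⟨y, hy, rfl⟩ := (isKummerModel_iff H.omitEntry_pos).1 hγ
  have hV (j : {j // j ≠ i}) : y j ∈ V := V.mem_of_powerSum_mem H.subsums (fun m h1 h2 => by
    rw [hy m h1 h2]
    exact (0 ^ _ : V).2) j
  refine ⟨fun j => ⟨y j, hV j⟩, fun m h1 h2 => ?_, by rw [map_starPoly]; rfl⟩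
  apply V.subtype_injective
  rw [map_powerSum, map_pow, map_zero]
  exact hy m h1 h2

theorem isKummerModel_starPoly {y : {j // j ≠ i} → V}
    (hy : IsPowerSumSolution (omitEntry a i) 0 y) :
    IsKummerModel (omitEntry a i) ((starPoly (omitEntry a i) y).map V.subtype) := by
  have := H.nonempty
  have h := hy.map V.subtype
  rw [map_zero] at h
  exact (isKummerModel_iff H.omitEntry_pos).2 ⟨_, h, map_starPoly _ _ _⟩

omit H in
variable (a i ρ) in
/-- A model `(1 - X) ^ a_i * g(ρX)` and a Kummer model correspond to each other if `g` and the
Kummer model have the same reduction. -/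
def Corresponds (β γ : QBar[X]) : Prop :=
  ∃ z y : {j // j ≠ i} → V,
    IsPowerSumSolution (omitEntry a i) ρ z ∧ IsPowerSumSolution (omitEntry a i) 0 y ∧
    (starPoly (omitEntry a i) z).map (IsLocalRing.residue V) =
      (starPoly (omitEntry a i) y).map (IsLocalRing.residue V) ∧
    β = (deformedModel a i ρ (starPoly (omitEntry a i) z)).map V.subtype ∧
    γ = (starPoly (omitEntry a i) y).map V.subtype

theorem exists_corresponds_of_mem_canonicalModels {β : QBar[X]} (hβ : β ∈ canonicalModels 𝔭 a) :
    ∃ γ, IsKummerModel (omitEntry a i) γ ∧ Corresponds a i ρ β γ := by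
  have := H.nonempty
  have := V.henselianLocalRing
  obtain ⟨z, hz, hβz⟩ := H.exists_solution_of_mem_canonicalModels hβ
  obtain ⟨y, hy, hyz⟩ := hz.exists_deformation H.subsums H.tame H.root_mem_maximalIdeal
    (IsLocalRing.maximalIdeal V).zero_mem
  refine ⟨_, H.isKummerModel_starPoly hy, z, y, hz, hy, ?_, hβz, rfl⟩
  simp only [map_starPoly, hyz]

theorem exists_corresponds_of_isKummerModel {γ : QBar[X]}
    (hγ : IsKummerModel (omitEntry a i) γ) :
    ∃ β ∈ canonicalModels 𝔭 a, Corresponds a i ρ β γ := by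
  have := H.nonempty
  have := V.henselianLocalRing
  obtain ⟨y, hy, hγy⟩ := H.exists_solution_of_isKummerModel hγ
  obtain ⟨z, hz, hzy⟩ := hy.exists_deformation H.subsums H.tame
    (IsLocalRing.maximalIdeal V).zero_mem H.root_mem_maximalIdeal
  refine ⟨_, H.deformedModel_mem_canonicalModels hz, z, y, hz, hy, ?_, rfl, hγy⟩
  simp only [map_starPoly, hzy]

/-- As `ρ ≠ 0`, the canonical model determines the polynomial of `z`, hence the reduction of the
Kummer model, hence the Kummer model. -/
theorem corresponds_right_unique {β γ γ' : QBar[X]} (h : Corresponds a i ρ β γ)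
    (h' : Corresponds a i ρ β γ') : γ = γ' := by
  have := H.nonempty
  obtain ⟨z, y, -, hy, hr, hβ, rfl⟩ := h
  obtain ⟨z', y', -, hy', hr', hβ', rfl⟩ := h'
  have hzz := deformedModel_injective a i H.root_ne_zero
    (map_injective _ V.subtype_injective (hβ.symm.trans hβ'))
  rw [hy.starPoly_eq_of_residue_eq H.subsums H.tame (IsLocalRing.maximalIdeal V).zero_mem hy'
    (by rw [← hr, hzz, hr'])]

theorem corresponds_left_unique {β β' γ : QBar[X]} (h : Corresponds a i ρ β γ)
    (h' : Corresponds a i ρ β' γ) : β = β' := by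
  have := H.nonempty
  obtain ⟨z, y, hz, -, hr, rfl, hγ⟩ := h
  obtain ⟨z', y', hz', -, hr', rfl, hγ'⟩ := h'
  have hyy := map_injective _ V.subtype_injective (hγ.symm.trans hγ')
  rw [hz.starPoly_eq_of_residue_eq H.subsums H.tame H.root_mem_maximalIdeal hz'
    (by rw [hr, hyy, hr'])]

theorem exists_equiv_corresponds :
    ∃ Φ : canonicalModels 𝔭 a ≃ kummerModels (omitEntry a i),
      ∀ β : canonicalModels 𝔭 a, Corresponds a i ρ (β : QBar[X]) (Φ β : QBar[X]) := by
  refine exists_equiv_of_rel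
    (r := fun (β : canonicalModels 𝔭 a) (γ : kummerModels (omitEntry a i)) =>
      Corresponds a i ρ (β : QBar[X]) (γ : QBar[X])) (fun β => ?_) (fun γ => ?_)
    (fun h h' => Subtype.ext (H.corresponds_right_unique h h'))
    (fun h h' => Subtype.ext (H.corresponds_left_unique h h'))
  · obtain ⟨γ, hγ, h⟩ := H.exists_corresponds_of_mem_canonicalModels β.2
    exact ⟨⟨γ, hγ⟩, h⟩
  · obtain ⟨β, hβ, h⟩ := H.exists_corresponds_of_isKummerModel γ.2
    exact ⟨⟨β, hβ⟩, h⟩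

end IsDegenerationPlace

end Correspondence

/-! ### Equivariance under the decomposition group. -/

section Equivariance

theorem ValuationSubring.mem_of_pow_mem {F : Type*} [Field F] (A : ValuationSubring F) {x : F}
    {m : ℕ} (hm : m ≠ 0) (h : x ^ m ∈ A) : x ∈ A := by
  rw [← A.valuation_le_one_iff, map_pow] at h
  rw [← A.valuation_le_one_iff]
  exact (pow_le_one_iff hm).1 h

theorem map_eq_kummerCocycle_mul {x : QBar} (hx : x ≠ 0) (σ : QBar ≃ₐ[ℚ] QBar) :
    σ x = kummerCocycle x σ * x := by
  rw [kummerCocycle, inv_mul_cancel_right₀ hx]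

theorem twistedGaloisAct_starPoly {ι : Type} [Fintype ι] (x : QBar) (σ : QBar ≃ₐ[ℚ] QBar)
    (w : ι → ℕ) (y : ι → QBar) :
    twistedGaloisAct x σ (starPoly w y) = starPoly w fun j => twistedAct x σ (y j) :=
  twistedGaloisAct_prod x σ w y

theorem coeff_twistedGaloisAct (x : QBar) (σ : QBar ≃ₐ[ℚ] QBar) (f : QBar[X]) (m : ℕ) :
    (twistedGaloisAct x σ f).coeff m = σ (f.coeff m) * kummerCocycle x σ ^ m := by
  rw [twistedGaloisAct, comp_C_mul_X_coeff, galoisAct, coeff_map]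
  rfl

theorem IsPowerSumSolution.twistedAct {ι : Type} [Fintype ι] {w : ι → ℕ} {x t : QBar}
    {σ : QBar ≃ₐ[ℚ] QBar} {u : ι → QBar} (hu : IsPowerSumSolution w t u)
    (hx : kummerCocycle x σ ^ Fintype.card ι = 1) (ht : σ t = kummerCocycle x σ * t) :
    IsPowerSumSolution w t fun j => twistedAct x σ (u j) := fun m h1 h2 => by
  have h3 : powerSum w m (fun j => σ (u j)) = σ (powerSum w m u) :=
    (map_powerSum (σ : QBar →+* QBar) w m u).symm
  have h4 : powerSum w m (fun j => _root_.twistedAct x σ (u j)) =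
      kummerCocycle x σ ^ m * powerSum w m (fun j => σ (u j)) := powerSum_mul _ _ _ _
  rw [h4, h3, hu m h1 h2, map_pow, ht, mul_pow, ← mul_assoc, ← pow_add, Nat.add_sub_cancel' h2,
    hx, one_mul]

variable {ι : Type} [Fintype ι] [DecidableEq ι] {a : ι → ℕ} {i : ι} {K : IntermediateField ℚ QBar}
  [NumberField K] {𝔭 : HeightOneSpectrum (𝓞 K)} {V : ValuationSubring QBar} {ρ : V}

namespace IsDegenerationPlace

variable (H : IsDegenerationPlace a i 𝔭 V ρ)

include H

/-- `V` need not be stable under `σ`; only its trace on `K`, the local ring at `𝔭`, is. Hence the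
condition that `t` lie in `K`. -/
theorem galois_mem {τ : K ≃ₐ[ℚ] K} (hτ : τ ∈ decompositionGroup 𝔭) {σ : QBar ≃ₐ[ℚ] QBar}
    (hσ : ∀ z : K, σ z = τ z) {t : QBar} (hK : t ∈ K) (hV : t ∈ V) : σ t ∈ V := by
  rw [show t = ((⟨t, hK⟩ : K) : QBar) from rfl, H.mem_iff] at hV
  rw [show t = ((⟨t, hK⟩ : K) : QBar) from rfl, hσ, H.mem_iff]
  exact decompositionGroup_apply_mem hτ hV

theorem galois_valuation_lt_one {τ : K ≃ₐ[ℚ] K} (hτ : τ ∈ decompositionGroup 𝔭)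
    {σ : QBar ≃ₐ[ℚ] QBar} (hσ : ∀ z : K, σ z = τ z) {t : QBar} (hK : t ∈ K)
    (hV : V.valuation t < 1) : V.valuation (σ t) < 1 := by
  rw [V.valuation_lt_one_iff_inv_not_mem] at hV ⊢
  refine hV.imp (fun h => by rw [h, map_zero]) fun h hmem => h ?_
  rw [← map_inv₀, show t⁻¹ = (((⟨t, hK⟩ : K)⁻¹ : K) : QBar) from rfl, hσ, H.mem_iff] at hmem
  have := decompositionGroup_apply_mem ((decompositionGroup 𝔭).inv_mem hτ) hmem
  rw [show τ⁻¹ = τ.symm from rfl, AlgEquiv.symm_apply_apply] at this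
  exact (H.mem_iff _).2 this

theorem kummerCocycle_pow (σ : QBar ≃ₐ[ℚ] QBar) :
    kummerCocycle ρ σ ^ Fintype.card {j // j ≠ i} = 1 := by
  have h := congrArg V.subtype H.pow_card
  rw [map_pow, map_neg, map_natCast] at h
  have h0 : (ρ : QBar) ≠ 0 := fun h => H.root_ne_zero (Subtype.ext h)
  have h' : (ρ : QBar) ^ Fintype.card {j // j ≠ i} = -(a i : QBar) := h
  rw [kummerCocycle, mul_pow, ← map_pow, inv_pow, h', map_neg, map_natCast, ← h']
  exact mul_inv_cancel₀ (pow_ne_zero _ h0)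

theorem corresponds_galoisAct {τ : K ≃ₐ[ℚ] K} (hτ : τ ∈ decompositionGroup 𝔭)
    {σ : QBar ≃ₐ[ℚ] QBar} (hσ : ∀ z : K, σ z = τ z) {β γ : QBar[X]}
    (h : Corresponds a i ρ β γ) :
    galoisAct σ β ∈ canonicalModels 𝔭 a ∧
      Corresponds a i ρ (galoisAct σ β) (twistedGaloisAct ρ σ γ) := by
  obtain ⟨z, y, hz, hy, hr, rfl, rfl⟩ := h
  have h0 : (ρ : QBar) ≠ 0 := fun h => H.root_ne_zero (Subtype.ext h)
  have hc := H.kummerCocycle_pow σ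
  have hcV : kummerCocycle (ρ : QBar) σ ∈ V :=
    V.mem_of_pow_mem H.card_pos.ne' (by rw [hc]; exact V.one_mem)
  have hzK := H.solution_mem hz
  have hz' := (hz.map V.subtype).twistedAct hc (map_eq_kummerCocycle_mul h0 σ)
  have hy' := (hy.map V.subtype).twistedAct hc (by rw [map_zero, map_zero, mul_zero])
  have hzV (j : {j // j ≠ i}) : twistedAct ρ σ (z j) ∈ V :=
    V.mul_mem _ _ hcV (H.galois_mem hτ hσ (hzK j) (z j).2)
  -- The `y j` need not lie in `K`, only the coefficients of the Kummer model do. Integrality of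
  -- their twisted conjugates therefore comes from the power sums.
  have hyV (j : {j // j ≠ i}) : twistedAct ρ σ (y j) ∈ V :=
    V.mem_of_powerSum_mem H.subsums
      (u := fun j => twistedAct ρ σ (V.subtype (y j)))
      (fun m h1 h2 => by
        rw [hy' m h1 h2, map_zero]
        exact ((0 : V) ^ _).2) j
  let z' : {j // j ≠ i} → V := fun j => ⟨_, hzV j⟩
  let y' : {j // j ≠ i} → V := fun j => ⟨_, hyV j⟩
  have hzs : IsPowerSumSolution (omitEntry a i) ρ z' := fun m h1 h2 => by
    apply V.subtype_injective
    rw [map_powerSum, map_pow]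
    exact hz' m h1 h2
  have hys : IsPowerSumSolution (omitEntry a i) 0 y' := fun m h1 h2 => by
    apply V.subtype_injective
    rw [map_powerSum, map_pow]
    exact hy' m h1 h2
  have hztw : (starPoly (omitEntry a i) z').map V.subtype =
      twistedGaloisAct ρ σ ((starPoly (omitEntry a i) z).map V.subtype) := by
    rw [map_starPoly, map_starPoly, twistedGaloisAct_starPoly]
    rfl
  have hytw : (starPoly (omitEntry a i) y').map V.subtype =
      twistedGaloisAct ρ σ ((starPoly (omitEntry a i) y).map V.subtype) := by
    rw [map_starPoly, map_starPoly, twistedGaloisAct_starPoly]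
    rfl
  -- The cocycle absorbs the change of `ρ`: `σ(ρ z_j) = ρ · (σ(ρ)/ρ) σ(z_j)`, and the entry `1` is
  -- fixed.
  have hgal : galoisAct σ ((deformedModel a i ρ (starPoly (omitEntry a i) z)).map V.subtype) =
      (deformedModel a i ρ (starPoly (omitEntry a i) z')).map V.subtype := by
    rw [deformedModel_starPoly, deformedModel_starPoly, map_starPoly, map_starPoly, galoisAct,
      map_starPoly]
    congr 1
    ext j
    by_cases hji : j = i
    · rw [hji, insertOne_self, insertOne_self, map_one, map_one]
    · rw [insertOne_of_ne i _ ⟨j, hji⟩, insertOne_of_ne i _ ⟨j, hji⟩]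
      change σ ((ρ : QBar) * z ⟨j, hji⟩) = ρ * (kummerCocycle ρ σ * σ (z ⟨j, hji⟩))
      rw [map_mul, map_eq_kummerCocycle_mul h0 σ]
      ring
  have hcoeffK (m : ℕ) : ((starPoly (omitEntry a i) z).map V.subtype).coeff m ∈ K := by
    have : (starPoly (omitEntry a i) z).map V.subtype =
        (starPoly (omitEntry a i) fun j => (⟨z j, hzK j⟩ : K)).map (algebraMap K QBar) := by
      rw [map_starPoly, map_starPoly]
      rfl
    rw [this, coeff_map]
    exact SetLike.coe_mem _
  have hcoeffK' (m : ℕ) : ((starPoly (omitEntry a i) y).map V.subtype).coeff m ∈ K :=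
    H.kummerField_le (coeff_mem_valencyKummerField (H.isKummerModel_starPoly hy) m)
  refine ⟨hgal ▸ H.deformedModel_mem_canonicalModels hzs, z', y', hzs, hys, ?_, hgal, hytw.symm⟩
  ext m
  -- Equality of reductions is a congruence between coefficients in `K`, so `σ` preserves it; the
  -- twist then multiplies by a power of the integral cocycle.
  have hd : V.valuation (((starPoly (omitEntry a i) z).map V.subtype).coeff m -
      ((starPoly (omitEntry a i) y).map V.subtype).coeff m) < 1 := by
    have := congrArg (fun f => coeff f m) hr
    simp only [coeff_map] at this
    rw [← sub_eq_zero, ← map_sub, IsLocalRing.residue_eq_zero_iff, V.valuation_lt_one_iff] at this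
    rw [coeff_map, coeff_map]
    exact this
  have hd' := H.galois_valuation_lt_one hτ hσ (K.sub_mem (hcoeffK m) (hcoeffK' m)) hd
  rw [coeff_map, coeff_map, ← sub_eq_zero, ← map_sub, IsLocalRing.residue_eq_zero_iff,
    V.valuation_lt_one_iff]
  have heq : (((starPoly (omitEntry a i) z').coeff m - (starPoly (omitEntry a i) y').coeff m : V) :
      QBar) = σ (((starPoly (omitEntry a i) z).map V.subtype).coeff m -
        ((starPoly (omitEntry a i) y).map V.subtype).coeff m) * kummerCocycle (ρ : QBar) σ ^ m := by
    rw [map_sub, sub_mul, ← coeff_twistedGaloisAct, ← coeff_twistedGaloisAct, ← hztw, ← hytw,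
      coeff_map, coeff_map]
    rfl
  rw [heq, map_mul]
  exact mul_lt_one_of_nonneg_of_lt_one_left zero_le hd'
    ((V.valuation_le_one_iff _).2 (V.pow_mem hcV m))

end IsDegenerationPlace

end Equivariance

/-! ### Good reduction of trees. -/

section GoodReduction

variable {ι : Type} {w : ι → ℕ}

theorem NonvanishingSubsums.map {k k' : Type*} [Field k] [Field k']
    (hw : NonvanishingSubsums k w) (f : k →+* k') : NonvanishingSubsums k' w := fun S hS h =>
  hw S hS (f.injective (by rw [map_natCast, map_zero, h]))

/-- The affine substitution sending `0` to a centre and `1` to a zero exists because these two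
points are distinct. -/
theorem DiameterFourTree.exists_normalizedModel [Nonempty ι] (T : DiameterFourTree QBar w) :
    ∃ β, T.HasModel β ∧ IsNormalizedModel w β := by
  obtain ⟨⟨β, hβ⟩, rfl⟩ := Quotient.exists_rep T
  obtain ⟨e, he⟩ := hβ.fiber_one
  obtain ⟨r, -, hr, -⟩ := hβ.fiber_zero
  obtain ⟨j⟩ := ‹Nonempty ι›
  have hrj : β.eval (r j) = 0 := hr.ge ⟨j, rfl⟩
  have hu : r j - e ≠ 0 := sub_ne_zero.2 fun h => by
    rw [h, he.1] at hrj
    exact one_ne_zero hrj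
  have hmodel := hβ.comp hu e
  refine ⟨_, ⟨hmodel, Quotient.sound ((modelSetoid QBar w).symm ⟨_, e, hu, rfl⟩)⟩,
    ⟨hmodel, IsCentre.comp hu (by rwa [mul_zero, zero_add])⟩, ?_⟩
  simpa [eval_comp] using hrj

/-- A tree has good reduction at the primes at which the subset sums of the type and the integers
up to the number of points above `0` are units. -/
theorem DiameterFourTree.hasGoodModelAt [Fintype ι] [Nonempty ι] (T : DiameterFourTree QBar w)
    {L : IntermediateField ℚ QBar} [NumberField L] {𝔔 : HeightOneSpectrum (𝓞 L)}
    (hT : T.splittingField ≤ L) (hw : NonvanishingSubsums (residueFieldAt 𝔔) w)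
    (htame : ∀ e, 1 ≤ e → e ≤ Fintype.card ι → (e : residueFieldAt 𝔔) ≠ 0) :
    T.HasGoodModelAt 𝔔 := by
  obtain ⟨β, hTβ, hβ⟩ := T.exists_normalizedModel
  obtain ⟨x, rfl⟩ := hβ.1.1.exists_eq_starPoly hβ.1.2.1
  have hx0 := hβ.1.1.injective_of_eq_starPoly.2
  have hpos := hβ.1.1.pos
  have hxL (j : ι) : x j ∈ L := by
    rw [← inv_inv (x j)]
    exact L.inv_mem (hT (IntermediateField.subset_adjoin ℚ _ ⟨_, hTβ, hβ,
      (starPoly_eval_eq_zero_iff hpos _ _).2 ⟨j, mul_inv_cancel₀ (hx0 j)⟩⟩))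
  have hsum (m : ℕ) (h1 : 1 ≤ m) (h2 : m < Fintype.card ι) :
      powerSum w m (fun j => (⟨x j, hxL j⟩ : L)) = 0 := by
    apply (algebraMap L QBar).injective
    rw [map_powerSum, map_zero]
    exact hβ.1.powerSum_eq_zero h1 h2
  obtain ⟨j₁, hj₁⟩ := (starPoly_eval_eq_zero_iff hpos _ _).1 hβ.2
  rw [mul_one] at hj₁
  -- Normalization supplies the entry `1`. It forces all inverse zeros to be integral and keeps
  -- their reduction nonzero, so the power sum criterion applies again over the residue field.
  have hmem := (localRingAt 𝔔).mem_of_powerSum_eq_zero hw hsum (Subtype.ext hj₁)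
  let v : ι → localRingAt 𝔔 := fun j => ⟨_, hmem j⟩
  have hv : v j₁ = 1 := Subtype.ext (Subtype.ext hj₁)
  have hvsum (m : ℕ) (h1 : 1 ≤ m) (h2 : m < Fintype.card ι) : powerSum w m v = 0 := by
    apply (localRingAt 𝔔).subtype_injective
    rw [map_powerSum, map_zero]
    exact hsum m h1 h2
  have hto : toQBar 𝔔 (starPoly w v) = starPoly w x := by
    rw [toQBar, map_starPoly]
    rfl
  refine ⟨starPoly w v, by rwa [hto], by rwa [hto], ?_⟩
  let κ := AlgebraicClosure (residueFieldAt 𝔔)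
  have hw' := hw.map (algebraMap (residueFieldAt 𝔔) κ)
  rw [reduceAt, map_starPoly]
  refine ⟨isStandardModel_starPoly hw' (fun e h1 h2 h => htame e h1 h2 ?_) (fun m h1 h2 => ?_)
    fun h => ?_, (starPoly_eval_eq_zero_iff hw'.pos _ _).2 ⟨j₁, ?_⟩⟩
  · apply (algebraMap (residueFieldAt 𝔔) κ).injective
    rw [map_natCast, map_zero, h]
  · rw [← map_powerSum, hvsum m h1 h2, map_zero]
  · have := congrFun h j₁
    rw [hv, map_one] at this
    exact one_ne_zero this
  · rw [hv, map_one, mul_one]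

end GoodReduction

/-! ### Assembling the theorem. -/

theorem theorem8p6 (n : ℕ) (a : Fin n → ℕ) (ha_pos : ∀ j, 0 < a j) (ha_mono : Monotone a)
    (i : Fin n) (p : ℕ) (hp : IsRegularPrime a i p) (hpn : n < p)
    (K : IntermediateField ℚ QBar) [NumberField K]
    (hK : valencySplittingField a ≤ K)
    (hK' : valencyKummerField (omitEntry a i) ≤ K)
    (hKh : IntermediateField.adjoin ℚ
      ((X ^ (n - 1) + C (a i : ℚ) : ℚ[X]).rootSet QBar) ≤ K)
    (x : QBar) (hx : x ^ (n - 1) + (a i : QBar) = 0)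
    (𝔭 : HeightOneSpectrum (𝓞 K)) (h𝔭 : 𝔭.asIdeal.LiesOver (Ideal.span {(p : ℤ)})) :
    (∃ Φ : canonicalModels 𝔭 a ≃ kummerModels (omitEntry a i),
      ∀ τ ∈ decompositionGroup 𝔭, ∀ σ : QBar ≃ₐ[ℚ] QBar, (∀ z : K, σ z = τ z) →
        ∀ β : canonicalModels 𝔭 a, ∃ hβ : galoisAct σ β ∈ canonicalModels 𝔭 a,
          (Φ ⟨galoisAct σ β, hβ⟩ : QBar[X]) = twistedGaloisAct x σ (Φ β)) ∧
    ∀ T : DiameterFourTree QBar (omitEntry a i), T.HasGoodReductionAt 𝔭 := by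
  have hcard : Fintype.card {j // j ≠ i} = n - 1 := by
    have h := card_eq_card_ne_add_one i
    rw [Fintype.card_fin] at h
    omega
  have hn : 2 ≤ n := by
    by_contra! hn
    have h1 : n - 1 = 0 := by omega
    rw [h1, pow_zero] at hx
    have : (1 + a i : ℕ) = 0 := by exact_mod_cast hx
    omega
  have hne : Nonempty {j // j ≠ i} := Fintype.card_pos_iff.1 (by omega)
  have hp𝔭 : (p : 𝓞 K) ∈ 𝔭.asIdeal := by
    have h1 : (p : ℤ) ∈ 𝔭.asIdeal.under ℤ := by
      rw [← h𝔭.over]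
      exact Ideal.mem_span_singleton_self _
    have h2 : algebraMap ℤ (𝓞 K) p ∈ 𝔭.asIdeal := h1
    simpa using h2
  obtain ⟨V, hV⟩ := exists_valuationSubring_extending (algebraMap K QBar) (localRingAt 𝔭)
  have hpV : (p : IsLocalRing.ResidueField V) = 0 := by
    have h := natCast_residueFieldAt_eq_zero hp𝔭
    rw [← map_natCast (IsLocalRing.residue (localRingAt 𝔭)), IsLocalRing.residue_eq_zero_iff,
      ValuationSubring.valuation_lt_one_iff,
      ValuationSubring.valuation_lt_one_iff_inv_not_mem] at h
    rw [← map_natCast (IsLocalRing.residue V), IsLocalRing.residue_eq_zero_iff,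
      ValuationSubring.valuation_lt_one_iff, ValuationSubring.valuation_lt_one_iff_inv_not_mem]
    refine Or.inr fun hmem => (h.resolve_left ?_) ((hV _).1 ?_)
    · simpa using hp.1.ne_zero
    · simpa using hmem
  have hxpow : x ^ (n - 1) = -(a i : QBar) := eq_neg_of_add_eq_zero_left hx
  -- A power of `x` with positive exponent is the integer `-a i`, so `x` is integral.
  have hxV : x ∈ V := V.mem_of_pow_mem (m := n - 1) (by omega) (by
    rw [hxpow]
    exact (-(a i : V)).2)
  have hxK : x ∈ K := hKh (IntermediateField.subset_adjoin ℚ _ ((mem_rootSet).2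
    ⟨(monic_X_pow_add_C _ (by omega)).ne_zero, by simpa using hx⟩))
  have H : IsDegenerationPlace a i 𝔭 V ⟨x, hxV⟩ :=
    { pos := ha_pos
      nonempty := hne
      subsums := hp.nonvanishingSubsums hpV
      tame := fun e h1 h2 => natCast_ne_zero_of_lt hp.1 hpV h1 (by omega)
      cast_eq_zero := by
        obtain ⟨b, hb⟩ := hp.2.1
        rw [hb, Nat.cast_mul, hpV, zero_mul]
      mem_iff := hV
      splittingField_le := hK
      kummerField_le := hK'
      pow_card := by
        rw [hcard]
        exact Subtype.ext hxpow
      root_mem := hxK }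
  refine ⟨?_, fun T L _ hKL 𝔔 hT h𝔔 => ?_⟩
  · obtain ⟨Φ, hΦ⟩ := H.exists_equiv_corresponds
    refine ⟨Φ, fun τ hτ σ hσ β => ?_⟩
    obtain ⟨hβ, h⟩ := H.corresponds_galoisAct hτ hσ (hΦ β)
    exact ⟨hβ, H.corresponds_right_unique (hΦ ⟨_, hβ⟩) h⟩
  · have hp𝔔 : (p : 𝓞 L) ∈ 𝔔.asIdeal := by
      rw [← h𝔔, Ideal.mem_comap, map_natCast] at hp𝔭
      exact hp𝔭
    have h0 := natCast_residueFieldAt_eq_zero hp𝔔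
    exact T.hasGoodModelAt hT (hp.nonvanishingSubsums h0) fun e h1 h2 =>
      natCast_ne_zero_of_lt hp.1 h0 h1 (by omega)
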